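/- **Discrete energetics.** Let $d\in\{2,3\}$, let $\Omega\subset\mathbb R^d$ be a bounded domain with Lipschitz boundary $\Gamma$, $T>0$, $p>1$, $\kappa>0$, $\chi>0$, and let $e(u)=\frac12(\nabla u+\nabla u^\top)$. Assume: * $\mathbb C(\alpha)=\gamma(\alpha)\mathbb C_1$ and $\mathbb D(\alpha)=\mathbb D_0+\chi\,\mathbb C(\alpha)$, where $\mathbb C_1,\mathbb D_0$ are symmetric positive definite linear maps on $\mathbb R^{d\times d}_{\rm sym}$ (Frobenius inner product), and $\gamma:\mathbb R\to\mathbb R$ is smooth, positive and strictly convex with $\gamma'(0)=0$; * $\phi:[0,1]\to\mathbb R$ is $C^1$ and concave with $\phi'(0)\ge0$; * $\zeta:\mathbb R\to\mathbb R\cup\{+\infty\}$ is convex and lower semicontinuous, $\inf_{v\neq0}\zeta(v)/|v|^2>0$, $\zeta(v)=+\infty$ for $v>0$, and $\zeta$ attains its minimum at $0$; * $\varrho\in L^\infty(\Omega)$ with $\operatorname{ess\,inf}\varrho>0$, $f\in L^2((0,T)\times\Omega;\mathbb R^d)$, $g\in L^2((0,T)\times\Gamma;\mathbb R^d)$, $u_0\in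 H^1(\Omega;\mathbb R^d)$, $v_0\in L^2(\Omega;\mathbb R^d)$, $\alpha_0\in W^{1,p}(\Omega)$, $0\le\alpha_0\le1$ a.e. Put $$\mathscr T(v)=\int_\Omega\frac\varrho2|v|^2\,dx,\qquad \mathscr E(u,\alpha)=\int_\Omega\frac12\mathbb C(\alpha)e(u){:}e(u)-\phi(\alpha)+\frac\kappa p|\nabla\alpha|^p\,dx,$$ $$\varXi(\alpha;v,r)=\int_\Omega\mathbb D(\alpha)e(v){:}e(v)+r\,\partial\zeta(r)\,dx .$$ Here $r\,\partial\zeta(r)$ is single-valued if $\zeta$ is differentiable at all negative points of its domain; in general its least element is meant. Let $\tau>0$ with $N=T/\tau\in\mathbb N$, and let $f_\tau^k=\frac1\tau\int_{(k-1)\tau}^{k\tau}f\,dt$, $g_\tau^k=\frac1\tau\int_{(k-1)\tau}^{k\tau}g\,dt$. Let $u_\tau^k\in H^1(\Omega;\mathbb R^d)$, $v_\tau^k\in L^2(\Omega;\mathbb R^d)$, $\alpha_\tau^k\in W^{1,p}(\Omega)$ with $0\le\alpha_\tau^k\le1$ a.e. ($k=0,\dots,N$) be a discrete solution, i.e. $u_\tau^0=u_0$,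 $v_\tau^0=v_0$, $\alpha_\tau^0=\alpha_0$ and, for $k=1,\dots,N$, with $v_\tau^{k-1/2}=\frac12(v_\tau^k+v_\tau^{k-1})$ and $r_\tau^k=\frac1\tau(\alpha_\tau^k-\alpha_\tau^{k-1})$: 1. $\frac1\tau(u_\tau^k-u_\tau^{k-1})=v_\tau^{k-1/2}$ a.e. in $\Omega$; 2. for all $w\in H^1(\Omega;\mathbb R^d)$, $$\int_\Omega\varrho\,\frac{v_\tau^k-v_\tau^{k-1}}\tau\cdot w+\Big(\mathbb C(\alpha_\tau^k)e(u_\tau^k)+\mathbb D(\alpha_\tau^{k-1})e(v_\tau^{k-1/2})\Big){:}e(w)\,dx=\int_\Omega f_\tau^k\cdot w\,dx+\int_\Gamma g_\tau^k\cdot w\,dS;$$ 3. $\zeta(r_\tau^k)\in L^1(\Omega)$ and, for all $z\in W^{1,p}(\Omega)\cap L^\infty(\Omega)$ with $\zeta(z)\in L^1(\Omega)$, $$\int_\Omega\zeta(r_\tau^k)\,dx\le\int_\Omega\zeta(z)+\Big(\frac12\gamma'(\alpha_\tau^k)\mathbb C_1e(u_\tau^k){:}e(u_\tau^k)-\phi'(\alpha_\tau^k)\Big)(z-r_\tau^k)+\kappa|\nabla\alpha_\tau^k|^{p-2}\nabla\alpha_\tau^k\cdot\nabla(z-r_\tau^k)\,dx.$$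 Denote by $u_\tau,v_\tau,\alpha_\tau$ the continuous piecewise affine interpolants on $[0,T]$ of these values, by a dot their time derivatives, and, for $(k-1)\tau<t\le k\tau$, $\underline\alpha_\tau(t)=\alpha_\tau^{k-1}$, $\overline f_\tau(t)=f_\tau^k$, $\overline g_\tau(t)=g_\tau^k$. Let $$\tau_0=\frac{\min_{[0,1]}\gamma''}{2\,|\mathbb A^{-1}|\,|\mathbb C_1|^2\,|\mathbb C_1^{-1}|\,\max_{[0,1]}(\gamma')^2}\qquad\text{(operator norms)},$$ where $\mathbb A$ is either of $\mathbb D_0$ and $\mathbb D(0)$. If $\tau\le\tau_0$, then $r_\tau^k\,\partial\zeta(r_\tau^k)\in L^1(\Omega)$ for $k=1,\dots,N$, and for every $t=k\tau$, $k=1,\dots,N$, $$\mathscr T(v_\tau(t))+\mathscr E(u_\tau(t),\alpha_\tau(t))+\Big(1-\sqrt{\frac\tau{\tau_0}}\Big)\int_0^t\varXi(\underline\alpha_\tau;\dot u_\tau,\dot\alpha_\tau)\,ds\le\mathscr T(v_0)+\mathscr E(u_0,\alpha_0)+\int_0^t\Big(\int_\Omega\overline f_\tau\cdot\dot u_\tau\,dx+\int_\Gamma\overline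 g_\tau\cdot\dot u_\tau\,dS\Big)ds .$$ -/

import Mathlib

open MeasureTheory Set Filter Topology
open scoped ContDiff ENNReal

noncomputable section

namespace DamageScheme

/-! ### Domain, weak derivatives, Sobolev spaces, traces -/

/-- Points (and vectors) of `ℝ^d` with the Euclidean norm. -/
abbrev Pt (d : ℕ) := EuclideanSpace ℝ (Fin d)

/-- Bounded domain with Lipschitz boundary: near each boundary point, `Ω` is the set lying
below the graph of a Lipschitz function over the hyperplane orthogonal to a unit vector `ν`. -/
structure IsLipschitzDomain {d : ℕ} (Ω : Set (Pt d)) : Prop where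
  isOpen : IsOpen Ω
  isConnected : IsConnected Ω
  isBounded : Bornology.IsBounded Ω
  lipschitz_boundary : ∀ x ∈ frontier Ω, ∃ ν : Pt d, ‖ν‖ = 1 ∧
    ∃ (K : NNReal) (h : Pt d → ℝ), LipschitzWith K h ∧
      ∃ U ∈ 𝓝 x, ∀ y ∈ U, (y ∈ Ω ↔ inner ℝ y ν < h (y - inner ℝ y ν • ν))

/-- Surface measure on the boundary of `Ω`. -/
def surf {d : ℕ} (Ω : Set (Pt d)) : Measure (Pt d) :=
  (Measure.euclideanHausdorffMeasure (d - 1)).restrict (frontier Ω)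

/-- The classical partial derivative `∂ψ/∂x_i`. -/
def partialD {d : ℕ} (i : Fin d) (ψ : Pt d → ℝ) (x : Pt d) : ℝ :=
  fderiv ℝ ψ x (EuclideanSpace.single i 1)

/-- `g` is the weak derivative of `u` in the direction `x_i` on `Ω`. -/
def HasWeakPartial {d : ℕ} (Ω : Set (Pt d)) (i : Fin d) (u g : Pt d → ℝ) : Prop :=
  LocallyIntegrableOn u Ω volume ∧ LocallyIntegrableOn g Ω volume ∧
  ∀ ψ : Pt d → ℝ, ContDiff ℝ ∞ ψ → HasCompactSupport ψ → tsupport ψ ⊆ Ω →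
    ∫ x in Ω, u x * partialD i ψ x = - ∫ x in Ω, g x * ψ x

open Classical in
/-- The weak partial derivative on `Ω` (unique up to null sets), and `0` if there is none. -/
def weakPartial {d : ℕ} (Ω : Set (Pt d)) (i : Fin d) (u : Pt d → ℝ) : Pt d → ℝ :=
  if h : ∃ g, HasWeakPartial Ω i u g then h.choose else 0

/-- `u ∈ W^{1,q}(Ω)`. -/
def MemW1 {d : ℕ} (Ω : Set (Pt d)) (q : ℝ≥0∞) (u : Pt d → ℝ) : Prop :=
  MemLp u q (volume.restrict Ω) ∧
  ∀ i, ∃ g, HasWeakPartial Ω i u g ∧ MemLp g q (volume.restrict Ω)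

/-- `u ∈ H^1(Ω; ℝ^d)`. -/
def MemH1 {d : ℕ} (Ω : Set (Pt d)) (u : Pt d → Pt d) : Prop :=
  ∀ j, MemW1 Ω 2 (fun x => u x j)

/-- The weak gradient of a scalar function. -/
def weakGrad {d : ℕ} (Ω : Set (Pt d)) (a : Pt d → ℝ) (x : Pt d) : Pt d :=
  WithLp.toLp 2 (fun i => weakPartial Ω i a x)

/-- `t` is the trace on the boundary of `u ∈ H^1(Ω; ℝ^d)`: the limit in `L^2` of the boundary
values of functions smooth up to the boundary that converge to `u` in `H^1`. -/
def IsTrace {d : ℕ} (Ω : Set (Pt d)) (u t : Pt d → Pt d) : Prop :=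
  MemLp t 2 (surf Ω) ∧
  ∃ φ : ℕ → Pt d → Pt d, (∀ n, ContDiff ℝ ∞ (φ n)) ∧
    Tendsto (fun n => eLpNorm (fun x => φ n x - u x) 2 (volume.restrict Ω)) atTop (𝓝 0) ∧
    (∀ i j, Tendsto (fun n => eLpNorm (fun x => partialD i (fun y => φ n y j) x
      - weakPartial Ω i (fun y => u y j) x) 2 (volume.restrict Ω)) atTop (𝓝 0)) ∧
    Tendsto (fun n => eLpNorm (fun x => φ n x - t x) 2 (surf Ω)) atTop (𝓝 0)

open Classical in
/-- The trace of `u` on the boundary. -/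
def trace {d : ℕ} (Ω : Set (Pt d)) (u : Pt d → Pt d) : Pt d → Pt d :=
  if h : ∃ t, IsTrace Ω u t then h.choose else 0

/-! ### Strains and tensors -/

/-- Symmetric `d × d` matrices with the Frobenius inner product. -/
abbrev SymMat (d : ℕ) : Submodule ℝ (EuclideanSpace ℝ (Fin d × Fin d)) where
  carrier := {e | ∀ i j, e (i, j) = e (j, i)}
  add_mem' := by
    intro a b ha hb i j
    simp [ha i j, hb i j]
  zero_mem' := by
    intro i j
    simp
  smul_mem' := by
    intro c a ha i j
    simp [ha i j]

/-- The small-strain tensor `e(u) = (∇u + ∇uᵀ)/2`, with weak derivatives on `Ω`. -/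
def strain {d : ℕ} (Ω : Set (Pt d)) (u : Pt d → Pt d) (x : Pt d) : SymMat d :=
  ⟨WithLp.toLp 2 (fun ij : Fin d × Fin d =>
    (weakPartial Ω ij.1 (fun y => u y ij.2) x + weakPartial Ω ij.2 (fun y => u y ij.1) x) / 2),
   by
    intro i j
    simp [add_comm]⟩

/-- Fourth-order tensors with minor symmetries, acting on symmetric matrices. -/
abbrev Tensor4 (d : ℕ) := SymMat d →L[ℝ] SymMat d

/-- Symmetric positive definite fourth-order tensors. -/
def Tensor4.SymPosDef {d : ℕ} (A : Tensor4 d) : Prop :=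
  (∀ e e' : SymMat d, inner ℝ (A e) e' = inner ℝ e (A e')) ∧
  ∀ e : SymMat d, e ≠ 0 → 0 < inner ℝ (A e) e

/-! ### The dissipation potential of damage -/

/-- The convex subdifferential of `ζ : ℝ → ℝ ∪ {+∞}`. -/
def subdiff (ζ : ℝ → EReal) (v : ℝ) : Set ℝ :=
  {ξ | ζ v ≠ ⊤ ∧ ∀ w : ℝ, ζ v + ((ξ * (w - v) : ℝ) : EReal) ≤ ζ w}

/-- The product `v ∂ζ(v)`. It is single-valued if `ζ` is smooth away from `v = 0`;
where it is set-valued, its least element is taken. -/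
def subdiffPower (ζ : ℝ → EReal) (v : ℝ) : ℝ :=
  sInf ((fun ξ => v * ξ) '' subdiff ζ v)

/-! ### Data of the model and its energies -/

/-- The material data: `ℂ(α) = γ(α) ℂ₁`, `𝔻(α) = 𝔻₀ + χ ℂ(α)`, the stored energy `φ` of damage,
the dissipation potential `ζ` of damage, mass density, and gradient coefficient and exponent. -/
structure Material (d : ℕ) where
  γ : ℝ → ℝ
  C₁ : Tensor4 d
  D₀ : Tensor4 d
  χ : ℝ
  φ : ℝ → ℝ
  ζ : ℝ → EReal
  ϱ : Pt d → ℝ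
  κ : ℝ
  p : ℝ

namespace Material

variable {d : ℕ} (M : Material d) (Ω : Set (Pt d))

/-- Elastic moduli. -/
def C (a : ℝ) : Tensor4 d := M.γ a • M.C₁

/-- Viscous moduli. -/
def D (a : ℝ) : Tensor4 d := M.D₀ + M.χ • M.C a

/-- Derivative of `φ : [0,1] → ℝ`. -/
def φ' (a : ℝ) : ℝ := derivWithin M.φ (Icc 0 1) a

/-- The standing assumptions on the material data. -/
structure Admissible : Prop where
  γ_smooth : ContDiff ℝ ∞ M.γ
  γ_pos : ∀ a, 0 < M.γ a
  γ_convex : StrictConvexOn ℝ univ M.γ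
  γ_zero : deriv M.γ 0 = 0
  C₁_posDef : M.C₁.SymPosDef
  D₀_posDef : M.D₀.SymPosDef
  χ_pos : 0 < M.χ
  φ_smooth : ContDiffOn ℝ 1 M.φ (Icc 0 1)
  φ_concave : ConcaveOn ℝ (Icc 0 1) M.φ
  φ_zero : 0 ≤ M.φ' 0
  ζ_proper : ∀ v, M.ζ v ≠ ⊥
  ζ_convex : ∀ x y a b : ℝ, 0 ≤ a → 0 ≤ b → a + b = 1 →
    M.ζ (a * x + b * y) ≤ (a : EReal) * M.ζ x + (b : EReal) * M.ζ y
  ζ_lsc : LowerSemicontinuous M.ζ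
  ζ_coercive : ∃ c : ℝ, 0 < c ∧ ∀ v : ℝ, v ≠ 0 → ((c * v ^ 2 : ℝ) : EReal) ≤ M.ζ v
  ζ_top : ∀ v : ℝ, 0 < v → M.ζ v = ⊤
  ζ_min : ∀ v : ℝ, M.ζ 0 ≤ M.ζ v
  ϱ_bounded : MemLp M.ϱ ⊤ (volume.restrict Ω)
  ϱ_pos : ∃ c : ℝ, 0 < c ∧ ∀ᵐ x ∂(volume.restrict Ω), c ≤ M.ϱ x
  κ_pos : 0 < M.κ
  one_lt_p : 1 < M.p

/-- Kinetic energy. -/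
def kinetic (v : Pt d → Pt d) : ℝ :=
  ∫ x in Ω, M.ϱ x / 2 * ‖v x‖ ^ 2

/-- Stored energy. -/
def stored (u : Pt d → Pt d) (a : Pt d → ℝ) : ℝ :=
  ∫ x in Ω, (1 / 2 * inner ℝ (M.C (a x) (strain Ω u x)) (strain Ω u x) - M.φ (a x)
    + M.κ / M.p * ‖weakGrad Ω a x‖ ^ M.p)

/-- Dissipation rate `∫ 𝔻(α)e(v):e(v) + α̇ ∂ζ(α̇) dx`. -/
def dissRate (a : Pt d → ℝ) (v : Pt d → Pt d) (r : Pt d → ℝ) : ℝ :=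
  ∫ x in Ω, (inner ℝ (M.D (a x) (strain Ω v x)) (strain Ω v x) + subdiffPower M.ζ (r x))

/-- The reference time step `min γ'' / (2 |𝔻⁻¹| |ℂ₁|² |ℂ₁⁻¹| max (γ')²)`, minimum and maximum
over `[0,1]`, with operator norms, where `A` stands for the viscous tensor `𝔻`. -/
def tau0 (A : Tensor4 d) : ℝ :=
  sInf (deriv (deriv M.γ) '' Icc 0 1) /
    (2 * ‖A.inverse‖ * ‖M.C₁‖ ^ 2 * ‖M.C₁.inverse‖ *
      sSup ((fun a => deriv M.γ a ^ 2) '' Icc 0 1))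

end Material

/-- External loading `∫_Ω f·u dx + ∫_Γ g·u dS`. -/
def load {d : ℕ} (Ω : Set (Pt d)) (f g u : Pt d → Pt d) : ℝ :=
  (∫ x in Ω, inner ℝ (f x) (u x)) + (∫ x, inner ℝ (g x) (trace Ω u x) ∂(surf Ω))

/-! ### Time discretisation -/

section Time

variable {X : Type*} [AddCommGroup X] [Module ℝ X]

/-- The index `k` of the time interval `((k-1)τ, kτ]` containing `t > 0`. -/
def level (τ t : ℝ) : ℕ := ⌈t / τ⌉₊

/-- Piecewise constant interpolant with value `a k` on `((k-1)τ, kτ]`. -/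
def upper {Y : Type*} (a : ℕ → Y) (τ t : ℝ) : Y := a (level τ t)

/-- Piecewise constant interpolant with value `a (k-1)` on `((k-1)τ, kτ]`. -/
def lower {Y : Type*} (a : ℕ → Y) (τ t : ℝ) : Y := a (level τ t - 1)

/-- Piecewise affine interpolant. -/
def affine (a : ℕ → X) (τ t : ℝ) : X :=
  ((t - ((level τ t : ℝ) - 1) * τ) / τ) • a (level τ t)
    + (((level τ t : ℝ) * τ - t) / τ) • a (level τ t - 1)

/-- Difference quotient `(a (k+1) - a k)/τ`. -/
def quot (a : ℕ → X) (τ : ℝ) (k : ℕ) : X := τ⁻¹ • (a (k + 1) - a k)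

/-- Time derivative of the piecewise affine interpolant (away from the grid points). -/
def affineDot (a : ℕ → X) (τ t : ℝ) : X := quot a τ (level τ t - 1)

/-- Mean value `(a (k+1) + a k)/2`. -/
def mid (a : ℕ → X) (k : ℕ) : X := (1 / 2 : ℝ) • (a (k + 1) + a k)

/-- Mean value of `f` over the time interval `((k-1)τ, kτ)`. -/
def timeMean {d : ℕ} (f : ℝ → Pt d → Pt d) (τ : ℝ) (k : ℕ) (x : Pt d) : Pt d :=
  τ⁻¹ • ∫ s in (((k : ℝ) - 1) * τ)..((k : ℝ) * τ), f s x

lemma level_eq {τ t : ℝ} (hτ : 0 < τ) (k : ℕ) (h₁ : (k : ℝ) * τ < t)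
    (h₂ : t ≤ ((k : ℝ) + 1) * τ) : level τ t = k + 1 := by
  unfold level
  rw [Nat.ceil_eq_iff (Nat.succ_ne_zero k)]
  constructor
  · rw [lt_div_iff₀ hτ]
    simpa using h₁
  · rw [div_le_iff₀ hτ]
    push_cast
    exact h₂

lemma affine_grid {τ : ℝ} (hτ : 0 < τ) (a : ℕ → X) (k : ℕ) :
    affine a τ (((k : ℝ) + 1) * τ) = a (k + 1) := by
  have h : level τ (((k : ℝ) + 1) * τ) = k + 1 :=
    level_eq hτ k (by nlinarith) le_rfl
  unfold affine
  rw [h]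
  have h1 : ((((k : ℝ) + 1) * τ - (((k + 1 : ℕ) : ℝ) - 1) * τ) / τ) = 1 := by
    push_cast
    field_simp
    ring
  have h2 : ((((k + 1 : ℕ) : ℝ) * τ - ((k : ℝ) + 1) * τ) / τ) = 0 := by
    push_cast
    simp
  rw [h1, h2]
  simp

lemma hasDerivAt_affine {X : Type*} [NormedAddCommGroup X] [NormedSpace ℝ X]
    {τ t : ℝ} (hτ : 0 < τ) (a : ℕ → X) (k : ℕ)
    (h₁ : (k : ℝ) * τ < t) (h₂ : t < ((k : ℝ) + 1) * τ) :
    HasDerivAt (affine a τ) (affineDot a τ t) t := by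
  have e : affine a τ =ᶠ[𝓝 t] fun s =>
      ((s - (k : ℝ) * τ) / τ) • a (k + 1) + ((((k : ℝ) + 1) * τ - s) / τ) • a k := by
    filter_upwards [Ioo_mem_nhds h₁ h₂] with s hs
    unfold affine
    rw [level_eq hτ k hs.1 hs.2.le]
    simp
  have e2 : affineDot a τ t = (1 / τ) • a (k + 1) + (-1 / τ) • a k := by
    unfold affineDot quot
    rw [level_eq hτ k h₁ h₂.le]
    simp only [Nat.add_sub_cancel, smul_sub, one_div, neg_div, neg_smul]
    abel
  rw [e2]
  refine HasDerivAt.congr_of_eventuallyEq ?_ e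
  exact ((((hasDerivAt_id t).sub_const _).div_const τ).smul_const _).add
    ((((hasDerivAt_id t).const_sub _).div_const τ).smul_const _)

end Time

/-- Weak solutions of the recursive boundary-value problems at the time levels `k = 0, …, N`,
with the loads `F k`, `G k` at level `k`. The momentum equation is tested by `H^1`-functions;
the inclusion for the damage rate is the corresponding variational inequality. -/
structure IsDiscreteSolution {d : ℕ} (M : Material d) (Ω : Set (Pt d)) (τ : ℝ) (N : ℕ)
    (F G : ℕ → Pt d → Pt d) (u₀ v₀ : Pt d → Pt d) (α₀ : Pt d → ℝ)
    (u v : ℕ → Pt d → Pt d) (α : ℕ → Pt d → ℝ) : Prop where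
  u_init : u 0 =ᵐ[volume.restrict Ω] u₀
  v_init : v 0 =ᵐ[volume.restrict Ω] v₀
  α_init : α 0 =ᵐ[volume.restrict Ω] α₀
  u_mem : ∀ k ≤ N, MemH1 Ω (u k)
  v_mem : ∀ k ≤ N, MemLp (v k) 2 (volume.restrict Ω)
  α_mem : ∀ k ≤ N, MemW1 Ω (ENNReal.ofReal M.p) (α k)
  α_range : ∀ k ≤ N, ∀ᵐ x ∂(volume.restrict Ω), α k x ∈ Icc (0 : ℝ) 1
  velocity : ∀ k < N, quot u τ k =ᵐ[volume.restrict Ω] mid v k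
  momentum : ∀ k < N, ∀ w : Pt d → Pt d, MemH1 Ω w →
    ∫ x in Ω, (M.ϱ x * inner ℝ (quot v τ k x) (w x)
      + inner ℝ (M.C (α (k + 1) x) (strain Ω (u (k + 1)) x)
          + M.D (α k x) (strain Ω (mid v k) x)) (strain Ω w x))
      = load Ω (F (k + 1)) (G (k + 1)) w
  rate_finite : ∀ k < N, ∀ᵐ x ∂(volume.restrict Ω), M.ζ (quot α τ k x) ≠ ⊤
  rate_integrable : ∀ k < N, IntegrableOn (fun x => (M.ζ (quot α τ k x)).toReal) Ω
  flow_rule : ∀ k < N, ∀ z : Pt d → ℝ,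
    MemW1 Ω (ENNReal.ofReal M.p) z → MemLp z ⊤ (volume.restrict Ω) →
    (∀ᵐ x ∂(volume.restrict Ω), M.ζ (z x) ≠ ⊤) →
    IntegrableOn (fun x => (M.ζ (z x)).toReal) Ω →
    ∫ x in Ω, (M.ζ (quot α τ k x)).toReal ≤
      ∫ x in Ω, ((M.ζ (z x)).toReal
        + (1 / 2 * deriv M.γ (α (k + 1) x)
            * inner ℝ (M.C₁ (strain Ω (u (k + 1)) x)) (strain Ω (u (k + 1)) x)
          - M.φ' (α (k + 1) x)) * (z x - quot α τ k x)
        + M.κ * ‖weakGrad Ω (α (k + 1)) x‖ ^ (M.p - 2)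
          * inner ℝ (weakGrad Ω (α (k + 1)) x)
              (weakGrad Ω z x - weakGrad Ω (quot α τ k) x))

end DamageScheme

end

noncomputable section

namespace DamageScheme

/-! ### Calculus of weak derivatives -/

section WeakDerivatives

variable {d : ℕ} {Ω : Set (Pt d)} {i : Fin d}

/-! Testing the momentum equation with the difference quotient of `u`, which equals the mean of two
consecutive velocities, turns the inertial term into the exact increment of the kinetic energy. The
viscous dissipation and the stress power remain. The load is carried along unchanged, so no trace
theory is needed.

The flow rule yields the dissipation of damage. Testing with zero rate would only give ζ(r) - ζ(0),
which convexity bounds by r∂ζ(r), the wrong way round. Testing with (1-ε)r and dividing by ε gives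
difference quotients that increase as ε decreases to 0, with integrals bounded by minus the driving
power; monotone convergence gives both integrability of r∂ζ(r) and the bound (`dissipation_le`).

Adding the two balances leaves stress power plus driving power, to be compared with the increment of
the stored energy. The terms in φ and the gradient obey tangent inequalities at the new level. The
elastic term is not jointly convex in strain and damage, and this is the crux
(`elastic_increment_le`). As the rate is nonpositive, the damage variable decreases within [0,1];
strong convexity of γ there supplies a negative multiple of (α_old - α_new)² ℂ₁e:e, with e the old
strain. By Young's inequality this absorbs the mixed term of damage and strain increments. What is
left is at most τ² times a multiple of ℂ₁ė:ė, with ė the strain rate; τ₀ is calibrated so that this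
is at most (τ/τ₀)τ 𝔻ė:ė, and τ/τ₀ ≤ √(τ/τ₀) because τ ≤ τ₀. Summation over the steps telescopes. -/

lemma integrableOn_mul_of_tsupport_subset {g ψ : Pt d → ℝ}
    (hg : LocallyIntegrableOn g Ω volume) (hψ : Continuous ψ) (hc : HasCompactSupport ψ)
    (hs : tsupport ψ ⊆ Ω) : IntegrableOn (fun x => g x * ψ x) Ω volume := by
  have h1 : IntegrableOn g (tsupport ψ) volume := hg.integrableOn_compact_subset hs hc
  have h2 : IntegrableOn (fun x => g x * ψ x) (tsupport ψ) volume :=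
    h1.mul_continuousOn hψ.continuousOn hc
  refine (integrableOn_iff_integrable_of_support_subset ?_).1 h2 |>.integrableOn
  exact (Function.support_mul_subset_right g ψ).trans (subset_tsupport ψ)

lemma continuous_partialD {ψ : Pt d → ℝ} (h : ContDiff ℝ ∞ ψ) : Continuous (partialD i ψ) := by
  have := h.continuous_fderiv (by simp)
  unfold partialD
  fun_prop

lemma tsupport_partialD_subset (ψ : Pt d → ℝ) : tsupport (partialD i ψ) ⊆ tsupport ψ := by
  refine closure_minimal ?_ (isClosed_tsupport ψ)
  intro x hx
  refine support_fderiv_subset ℝ (f := ψ) ?_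
  intro h0
  apply hx
  simp [partialD, h0]

lemma hasCompactSupport_partialD {ψ : Pt d → ℝ} (hc : HasCompactSupport ψ) :
    HasCompactSupport (partialD i ψ) :=
  hc.of_isClosed_subset (isClosed_tsupport _) (tsupport_partialD_subset ψ)

lemma HasWeakPartial.congr_left {u v g : Pt d → ℝ} (h : HasWeakPartial Ω i u g)
    (huv : u =ᵐ[volume.restrict Ω] v) : HasWeakPartial Ω i v g := by
  refine ⟨h.1.congr huv, h.2.1, fun ψ h1 h2 h3 => ?_⟩
  rw [← h.2.2 ψ h1 h2 h3]
  refine integral_congr_ae ?_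
  filter_upwards [huv] with x hx
  rw [hx]

lemma hasWeakPartial_congr {u v : Pt d → ℝ} (huv : u =ᵐ[volume.restrict Ω] v) :
    HasWeakPartial Ω i u = HasWeakPartial Ω i v := by
  funext g
  exact propext ⟨fun h => h.congr_left huv, fun h => h.congr_left huv.symm⟩

/-- The equality holds everywhere, not just almost everywhere: both sides are chosen from the same
predicate. -/
lemma weakPartial_congr {u v : Pt d → ℝ} (huv : u =ᵐ[volume.restrict Ω] v) :
    weakPartial Ω i u = weakPartial Ω i v := by
  unfold weakPartial
  rw [hasWeakPartial_congr huv]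

/-- Fundamental lemma of the calculus of variations. It transfers linearity and integrability to the
representative chosen in `weakPartial`. -/
lemma HasWeakPartial.unique (hΩ : IsOpen Ω) {u g h : Pt d → ℝ} (hg : HasWeakPartial Ω i u g)
    (hh : HasWeakPartial Ω i u h) : g =ᵐ[volume.restrict Ω] h := by
  have key : ∀ᵐ x, x ∈ Ω → (g - h) x = 0 := by
    refine hΩ.ae_eq_zero_of_integral_contDiff_smul_eq_zero (hg.2.1.sub hh.2.1) ?_
    intro ψ h1 h2 h3
    have e1 := hg.2.2 ψ h1 h2 h3
    have e2 := hh.2.2 ψ h1 h2 h3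
    have i1 := integrableOn_mul_of_tsupport_subset hg.2.1 h1.continuous h2 h3
    have i2 := integrableOn_mul_of_tsupport_subset hh.2.1 h1.continuous h2 h3
    have e3 : ∫ x in Ω, (g x * ψ x - h x * ψ x) = 0 := by
      rw [integral_sub i1 i2]
      linarith
    rw [← e3, setIntegral_eq_integral_of_forall_compl_eq_zero]
    · refine integral_congr_ae (Eventually.of_forall fun x => ?_)
      simp only [Pi.sub_apply, smul_eq_mul]
      ring
    · intro x hx
      have : ψ x = 0 := image_eq_zero_of_notMem_tsupport fun h => hx (h3 h)
      simp [this]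
  rw [EventuallyEq, ae_restrict_iff' hΩ.measurableSet]
  filter_upwards [key] with x hx hxΩ
  have := hx hxΩ
  simp only [Pi.sub_apply] at this
  linarith

lemma hasWeakPartial_weakPartial {u : Pt d → ℝ} (h : ∃ g, HasWeakPartial Ω i u g) :
    HasWeakPartial Ω i u (weakPartial Ω i u) := by
  unfold weakPartial
  rw [dif_pos h]
  exact h.choose_spec

lemma HasWeakPartial.linear_comb {u v g h : Pt d → ℝ}
    (hu : HasWeakPartial Ω i u g) (hv : HasWeakPartial Ω i v h) (a b : ℝ) :
    HasWeakPartial Ω i (fun x => a * u x + b * v x) (fun x => a * g x + b * h x) := by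
  refine ⟨(hu.1.smul a).add (hv.1.smul b), (hu.2.1.smul a).add (hv.2.1.smul b), ?_⟩
  intro ψ h1 h2 h3
  have e1 := hu.2.2 ψ h1 h2 h3
  have e2 := hv.2.2 ψ h1 h2 h3
  have i1 := integrableOn_mul_of_tsupport_subset hu.2.1 h1.continuous h2 h3
  have i2 := integrableOn_mul_of_tsupport_subset hv.2.1 h1.continuous h2 h3
  have s := (tsupport_partialD_subset (i := i) ψ).trans h3
  have i3 := integrableOn_mul_of_tsupport_subset hu.1 (continuous_partialD (i := i) h1)
    (hasCompactSupport_partialD h2) s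
  have i4 := integrableOn_mul_of_tsupport_subset hv.1 (continuous_partialD (i := i) h1)
    (hasCompactSupport_partialD h2) s
  simp only [add_mul, mul_assoc]
  rw [integral_add (i3.const_mul a) (i4.const_mul b),
    integral_add (i1.const_mul a) (i2.const_mul b)]
  simp only [integral_const_mul, e1, e2]
  ring

variable {q : ℝ≥0∞}

lemma MemW1.linear_comb {u v : Pt d → ℝ} (hu : MemW1 Ω q u) (hv : MemW1 Ω q v)
    (a b : ℝ) : MemW1 Ω q (fun x => a * u x + b * v x) := by
  refine ⟨(hu.1.const_mul a).add (hv.1.const_mul b), fun i => ?_⟩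
  obtain ⟨g, hg, hg'⟩ := hu.2 i
  obtain ⟨h, hh, hh'⟩ := hv.2 i
  exact ⟨_, hg.linear_comb hh a b, (hg'.const_mul a).add (hh'.const_mul b)⟩

lemma MemW1.const_mul {u : Pt d → ℝ} (hu : MemW1 Ω q u) (a : ℝ) :
    MemW1 Ω q (fun x => a * u x) := by
  simpa using hu.linear_comb hu a 0

lemma MemW1.exists_weakPartial {u : Pt d → ℝ} (hu : MemW1 Ω q u) (i : Fin d) :
    ∃ g, HasWeakPartial Ω i u g :=
  (hu.2 i).imp fun _ h => h.1

lemma MemW1.memLp_weakPartial (hΩ : IsOpen Ω) {u : Pt d → ℝ} (hu : MemW1 Ω q u) (i : Fin d) :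
    MemLp (weakPartial Ω i u) q (volume.restrict Ω) := by
  obtain ⟨g, hg, hg'⟩ := hu.2 i
  exact hg'.ae_eq (hg.unique hΩ (hasWeakPartial_weakPartial ⟨g, hg⟩))

lemma weakPartial_linear_comb (hΩ : IsOpen Ω) {u v : Pt d → ℝ} (hu : MemW1 Ω q u)
    (hv : MemW1 Ω q v) (a b : ℝ) (i : Fin d) :
    weakPartial Ω i (fun x => a * u x + b * v x) =ᵐ[volume.restrict Ω]
      fun x => a * weakPartial Ω i u x + b * weakPartial Ω i v x := by
  have h := (hasWeakPartial_weakPartial (hu.exists_weakPartial i)).linear_comb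
    (hasWeakPartial_weakPartial (hv.exists_weakPartial i)) a b
  exact (hasWeakPartial_weakPartial ⟨_, h⟩).unique hΩ h

lemma weakGrad_linear_comb (hΩ : IsOpen Ω) {u v : Pt d → ℝ} (hu : MemW1 Ω q u)
    (hv : MemW1 Ω q v) (a b : ℝ) :
    weakGrad Ω (fun x => a * u x + b * v x) =ᵐ[volume.restrict Ω]
      fun x => a • weakGrad Ω u x + b • weakGrad Ω v x := by
  have h := ae_all_iff.2 fun i => weakPartial_linear_comb hΩ hu hv a b i
  filter_upwards [h] with x hx
  ext i
  simp [weakGrad, hx i]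

lemma weakGrad_const_mul (hΩ : IsOpen Ω) {u : Pt d → ℝ} (hu : MemW1 Ω q u) (a : ℝ) :
    weakGrad Ω (fun x => a * u x) =ᵐ[volume.restrict Ω] fun x => a • weakGrad Ω u x := by
  simpa using weakGrad_linear_comb hΩ hu hu a 0

lemma weakGrad_congr {u v : Pt d → ℝ} (huv : u =ᵐ[volume.restrict Ω] v) :
    weakGrad Ω u = weakGrad Ω v := by
  funext x
  simp only [weakGrad, weakPartial_congr huv]

lemma MemW1.memLp_weakGrad (hΩ : IsOpen Ω) {u : Pt d → ℝ} (hu : MemW1 Ω q u) :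
    MemLp (weakGrad Ω u) q (volume.restrict Ω) :=
  memLp_piLp_iff.2 fun i => hu.memLp_weakPartial hΩ i

lemma MemH1.linear_comb {u v : Pt d → Pt d} (hu : MemH1 Ω u) (hv : MemH1 Ω v)
    (a b : ℝ) : MemH1 Ω (fun x => a • u x + b • v x) := by
  intro j
  simpa using (hu j).linear_comb (hv j) a b

lemma strain_congr {u v : Pt d → Pt d} (huv : u =ᵐ[volume.restrict Ω] v) :
    strain Ω u = strain Ω v := by
  have h : ∀ i j : Fin d, weakPartial Ω i (fun y => u y j) = weakPartial Ω i (fun y => v y j) :=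
    fun i j => weakPartial_congr (huv.fun_comp fun y : Pt d => y j)
  funext x
  simp only [strain, h]

lemma strain_linear_comb (hΩ : IsOpen Ω) {u v : Pt d → Pt d} (hu : MemH1 Ω u) (hv : MemH1 Ω v)
    (a b : ℝ) : strain Ω (fun x => a • u x + b • v x) =ᵐ[volume.restrict Ω]
      fun x => a • strain Ω u x + b • strain Ω v x := by
  have h := ae_all_iff.2 fun i => ae_all_iff.2 fun j =>
    weakPartial_linear_comb hΩ (hu j) (hv j) a b i
  filter_upwards [h] with x hx
  ext ⟨i, j⟩
  simp only [strain, PiLp.add_apply, PiLp.smul_apply, smul_eq_mul, Submodule.coe_add,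
    Submodule.coe_smul, hx i j, hx j i]
  ring

lemma MemH1.memLp_strain (hΩ : IsOpen Ω) {u : Pt d → Pt d} (hu : MemH1 Ω u) :
    MemLp (strain Ω u) 2 (volume.restrict Ω) := by
  have h : MemLp (fun x => (strain Ω u x : EuclideanSpace ℝ (Fin d × Fin d))) 2
      (volume.restrict Ω) := by
    refine memLp_piLp_iff.2 fun ij => ?_
    have := (((hu ij.2).memLp_weakPartial hΩ ij.1).add
      ((hu ij.1).memLp_weakPartial hΩ ij.2)).const_mul (1 / 2)
    refine this.ae_eq (Eventually.of_forall fun x => ?_)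
    simp only [strain, Pi.add_apply]
    ring
  have hm : AEStronglyMeasurable (strain Ω u) (volume.restrict Ω) :=
    (Topology.IsEmbedding.subtypeVal.aestronglyMeasurable_comp_iff).1 h.1
  exact (memLp_norm_iff hm).1 h.norm

end WeakDerivatives

/-! ### Symmetric positive definite tensors -/

section Tensors

variable {d : ℕ}

lemma SymMat.inner_smul_left (c : ℝ) (e e' : SymMat d) :
    inner ℝ (c • e) e' = c * inner ℝ e e' :=
  real_inner_smul_left e e' c

lemma SymMat.inner_smul_right (c : ℝ) (e e' : SymMat d) :
    inner ℝ e (c • e') = c * inner ℝ e e' :=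
  real_inner_smul_right e e' c

lemma Tensor4.SymPosDef.nonneg {A : Tensor4 d} (hA : A.SymPosDef) (e : SymMat d) :
    0 ≤ inner ℝ (A e) e := by
  rcases eq_or_ne e 0 with rfl | h
  · simp
  · exact (hA.2 e h).le

lemma Tensor4.SymPosDef.comm {A : Tensor4 d} (hA : A.SymPosDef) (e e' : SymMat d) :
    inner ℝ (A e) e' = inner ℝ (A e') e := by
  rw [hA.1, real_inner_comm]

lemma Tensor4.SymPosDef.quadratic_nonneg {A : Tensor4 d} (hA : A.SymPosDef) (e e' : SymMat d)
    (a b : ℝ) : 0 ≤ a ^ 2 * inner ℝ (A e) e + 2 * a * b * inner ℝ (A e) e'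
      + b ^ 2 * inner ℝ (A e') e' := by
  have h := hA.nonneg (a • e + b • e')
  simp only [map_add, map_smul, inner_add_left, inner_add_right, SymMat.inner_smul_left,
    SymMat.inner_smul_right] at h
  rw [hA.comm e' e] at h
  linarith

lemma Tensor4.SymPosDef.add {A B : Tensor4 d} (hA : A.SymPosDef) (hB : B.SymPosDef) :
    (A + B).SymPosDef := by
  refine ⟨fun e e' => ?_, fun e he => ?_⟩
  · simp only [add_apply, inner_add_left, inner_add_right, hA.1 e e',
      hB.1 e e']
  · simpa only [add_apply, inner_add_left] using add_pos (hA.2 e he) (hB.2 e he)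

lemma Tensor4.SymPosDef.smul {A : Tensor4 d} (hA : A.SymPosDef) {c : ℝ} (hc : 0 < c) :
    (c • A).SymPosDef := by
  refine ⟨fun e e' => ?_, fun e he => ?_⟩
  · simp only [smul_apply, SymMat.inner_smul_left, SymMat.inner_smul_right, hA.1]
  · simpa only [smul_apply, SymMat.inner_smul_left] using mul_pos hc (hA.2 e he)

lemma Tensor4.inner_le (A : Tensor4 d) (e : SymMat d) :
    inner ℝ (A e) e ≤ ‖A‖ * ‖e‖ ^ 2 := by
  calc inner ℝ (A e) e ≤ ‖A e‖ * ‖e‖ := real_inner_le_norm _ _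
    _ ≤ ‖A‖ * ‖e‖ * ‖e‖ := by gcongr; exact A.le_opNorm e
    _ = _ := by ring

/-- `ContinuousLinearMap.inverse` is 0 on non-invertible maps, so invertibility is required:
definiteness gives injectivity, which suffices in finite dimension. -/
lemma Tensor4.SymPosDef.apply_inverse {A : Tensor4 d} (hA : A.SymPosDef) (e : SymMat d) :
    A (A.inverse e) = e := by
  have hinj : Function.Injective (A : SymMat d →ₗ[ℝ] SymMat d) := by
    rw [← LinearMap.ker_eq_bot, LinearMap.ker_eq_bot']
    intro x hx
    by_contra h
    have := hA.2 x h
    rw [show A x = 0 from hx, inner_zero_left] at this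
    exact lt_irrefl _ this
  let L := (LinearEquiv.ofInjectiveEndo (A : SymMat d →ₗ[ℝ] SymMat d) hinj).toContinuousLinearEquiv
  have hL : (L : SymMat d →L[ℝ] SymMat d) = A := by
    ext1 x
    rfl
  rw [← hL, ContinuousLinearMap.inverse_equiv]
  simp

/-- Coercivity of a symmetric positive definite tensor with the constant `1 / ‖A⁻¹‖`. -/
lemma Tensor4.SymPosDef.norm_sq_le {A : Tensor4 d} (hA : A.SymPosDef) (e : SymMat d) :
    ‖e‖ ^ 2 ≤ ‖A.inverse‖ * inner ℝ (A e) e := by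
  rcases eq_or_ne e 0 with rfl | he
  · simp
  have h1 : inner ℝ (A (A.inverse e)) e = ‖e‖ ^ 2 := by
    rw [hA.apply_inverse, real_inner_self_eq_norm_sq]
  have h2 : inner ℝ (A (A.inverse e)) (A.inverse e) ≤ ‖A.inverse‖ * ‖e‖ ^ 2 := by
    rw [hA.apply_inverse, real_inner_comm]
    exact Tensor4.inner_le _ _
  have h3 := hA.2 e he
  -- Cauchy–Schwarz in the inner product of `A` for `A⁻¹e` and `e`; these are the weights minimising
  -- the quadratic form up to scaling.
  have h4 := hA.quadratic_nonneg (A.inverse e) e (inner ℝ (A e) e) (-‖e‖ ^ 2)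
  rw [h1] at h4
  have he2 : 0 < ‖e‖ ^ 2 := by positivity
  have h5 : (inner ℝ (A e) e) * ((‖e‖ ^ 2) * (‖e‖ ^ 2 - ‖A.inverse‖ * inner ℝ (A e) e)) ≤ 0 := by
    nlinarith [mul_le_mul_of_nonneg_left h2 (sq_nonneg (inner ℝ (A e) e))]
  by_contra hlt
  push Not at hlt
  have := mul_pos h3 (mul_pos he2 (sub_pos.2 hlt))
  linarith

end Tensors

/-! ### Convexity inequalities -/

/-- Subtracting m y²/2 leaves a convex function on [0,1], which lies above its tangent at `b`. -/
lemma quadratic_lower_bound_of_deriv2_ge {γ : ℝ → ℝ} (hγ : ContDiff ℝ ∞ γ) {m : ℝ}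
    (hm : ∀ x ∈ Icc (0 : ℝ) 1, m ≤ deriv (deriv γ) x) {a b : ℝ} (hb : 0 ≤ b) (hab : b ≤ a)
    (ha : a ≤ 1) : γ b + deriv γ b * (a - b) + m / 2 * (a - b) ^ 2 ≤ γ a := by
  rcases hab.eq_or_lt with rfl | hlt
  · simp
  have hd : Differentiable ℝ γ := hγ.differentiable (by simp)
  have hd2 : Differentiable ℝ (deriv γ) :=
    (contDiff_infty_iff_deriv.1 hγ).2.differentiable (by simp)
  have h1 : ∀ x, HasDerivAt (fun y => γ y - m / 2 * y ^ 2) (deriv γ x - m * x) x := by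
    intro x
    have h := (hd x).hasDerivAt.fun_sub ((hasDerivAt_pow 2 x).const_mul (m / 2))
    refine h.congr_deriv ?_
    push_cast
    ring
  have h2 : ∀ x, HasDerivAt (fun y => deriv γ y - m * y) (deriv (deriv γ) x - m) x := by
    intro x
    simpa using (hd2 x).hasDerivAt.fun_sub ((hasDerivAt_id x).const_mul m)
  have hc : ConvexOn ℝ (Icc (0 : ℝ) 1) (fun y => γ y - m / 2 * y ^ 2) := by
    refine convexOn_of_hasDerivWithinAt2_nonneg (convex_Icc 0 1)
      (f' := fun y => deriv γ y - m * y) (f'' := fun x => deriv (deriv γ) x - m)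
      (fun x _ => (h1 x).continuousAt.continuousWithinAt) (fun x _ => (h1 x).hasDerivWithinAt)
      (fun x _ => (h2 x).hasDerivWithinAt) ?_
    intro x hx
    have := hm x (interior_subset hx)
    linarith
  have h3 := hc.le_slope_of_hasDerivAt (x := b) (y := a) ⟨hb, hab.trans ha⟩
    ⟨hb.trans hab, ha⟩ hlt (h1 b)
  rw [slope_def_field, le_div_iff₀ (sub_pos.2 hlt)] at h3
  nlinarith

lemma le_tangent_of_concaveOn_Icc {φ : ℝ → ℝ} (hc : ConcaveOn ℝ (Icc (0 : ℝ) 1) φ)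
    (hd : ContDiffOn ℝ 1 φ (Icc 0 1)) {a b : ℝ} (ha : a ∈ Icc (0 : ℝ) 1)
    (hb : b ∈ Icc (0 : ℝ) 1) (hab : b ≤ a) :
    φ a ≤ φ b + derivWithin φ (Icc 0 1) b * (a - b) := by
  rcases hab.eq_or_lt with rfl | hlt
  · simp
  have h := hc.slope_le_derivWithin hb ha hlt (hd.differentiableOn (by simp) b hb)
  rw [slope_def_field, div_le_iff₀ (sub_pos.2 hlt)] at h
  linarith

/-- Convexity of ‖·‖^p / p, obtained from Cauchy–Schwarz and Young's inequality with conjugate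
exponents. -/
lemma rpow_norm_tangent_le {V : Type*} [NormedAddCommGroup V] [InnerProductSpace ℝ V] {p : ℝ}
    (hp : 1 < p) (x y : V) :
    ‖y‖ ^ p / p + ‖y‖ ^ (p - 2) * inner ℝ y (x - y) ≤ ‖x‖ ^ p / p := by
  have hp0 : 0 < p := by linarith
  -- At y = 0 the inner product vanishes, so the value of 0 ^ (p - 2) is irrelevant even for p < 2.
  rcases eq_or_ne y 0 with rfl | hy
  · simp only [norm_zero, inner_zero_left, mul_zero, Real.zero_rpow hp0.ne', zero_div, add_zero]
    positivity
  have hy' : 0 < ‖y‖ := norm_pos_iff.2 hy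
  have hpq := Real.HolderConjugate.conjExponent hp
  have h1 := Real.young_inequality_of_nonneg (norm_nonneg x)
    (Real.rpow_nonneg (norm_nonneg y) (p - 1)) hpq
  have h2 : (‖y‖ ^ (p - 1)) ^ Real.conjExponent p = ‖y‖ ^ p := by
    rw [← Real.rpow_mul hy'.le]
    congr 1
    unfold Real.conjExponent
    have : p - 1 ≠ 0 := by linarith
    field_simp
  have h3 : ‖y‖ ^ p / Real.conjExponent p = ‖y‖ ^ p - ‖y‖ ^ p / p := by
    unfold Real.conjExponent
    have : p - 1 ≠ 0 := by linarith
    field_simp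
  have h4 : ‖y‖ ^ (p - 2) * ‖y‖ = ‖y‖ ^ (p - 1) := by
    rw [← Real.rpow_add_one hy'.ne']
    ring_nf
  have h5 : ‖y‖ ^ (p - 2) * ‖y‖ ^ 2 = ‖y‖ ^ p := by
    rw [← Real.rpow_natCast ‖y‖ 2, ← Real.rpow_add hy']
    norm_num
  have h6 : ‖y‖ ^ (p - 2) * inner ℝ y x ≤ ‖x‖ * ‖y‖ ^ (p - 1) := by
    calc ‖y‖ ^ (p - 2) * inner ℝ y x ≤ ‖y‖ ^ (p - 2) * (‖y‖ * ‖x‖) := by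
          gcongr
          exact real_inner_le_norm _ _
      _ = ‖x‖ * ‖y‖ ^ (p - 1) := by rw [← h4]; ring
  rw [inner_sub_right, real_inner_self_eq_norm_sq, mul_sub, h5]
  rw [h2, h3] at h1
  linarith

/-- The tangent inequality at `x` and at `-x`. It gives an integrable majorant for the p-Laplacian
term. -/
lemma abs_rpow_mul_inner_le {V : Type*} [NormedAddCommGroup V] [InnerProductSpace ℝ V] {p : ℝ}
    (hp : 1 < p) (x y : V) :
    |‖y‖ ^ (p - 2) * inner ℝ y x| ≤ ‖x‖ ^ p + ‖y‖ ^ p := by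
  have hp0 : 0 < p := by linarith
  have key : ∀ z : V, ‖y‖ ^ (p - 2) * inner ℝ y z ≤ ‖z‖ ^ p + ‖y‖ ^ p := by
    intro z
    rcases eq_or_ne y 0 with rfl | hy
    · simp only [inner_zero_left, mul_zero]
      positivity
    have h := rpow_norm_tangent_le hp z y
    have hy' : 0 < ‖y‖ := norm_pos_iff.2 hy
    have h5 : ‖y‖ ^ (p - 2) * ‖y‖ ^ 2 = ‖y‖ ^ p := by
      rw [← Real.rpow_natCast ‖y‖ 2, ← Real.rpow_add hy']
      norm_num
    rw [inner_sub_right, real_inner_self_eq_norm_sq, mul_sub, h5] at h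
    have h6 : ‖z‖ ^ p / p ≤ ‖z‖ ^ p := div_le_self (by positivity) hp.le
    have h7 : 0 ≤ ‖y‖ ^ p / p := by positivity
    linarith
  rw [abs_le']
  refine ⟨key x, ?_⟩
  have h := key (-x)
  rwa [inner_neg_right, norm_neg, mul_neg] at h

/-! ### The elastic energy and the reference time step -/

section Elastic

variable {d : ℕ} {M : Material d} {Ω : Set (Pt d)}

lemma Material.Admissible.deriv_γ_nonneg (hM : M.Admissible Ω) {a : ℝ} (ha : 0 ≤ a) :
    0 ≤ deriv M.γ a := by
  have hd : Differentiable ℝ M.γ := hM.γ_smooth.differentiable (by simp)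
  rw [← hM.γ_zero]
  exact hM.γ_convex.convexOn.monotoneOn_deriv (fun x _ => hd x) (mem_univ _) (mem_univ _) ha

/-- The tangent of γ at 0 is horizontal. This is what places 𝔻(0) below 𝔻(a). -/
lemma Material.Admissible.γ_zero_le (hM : M.Admissible Ω) {a : ℝ} (ha : 0 ≤ a) :
    M.γ 0 ≤ M.γ a := by
  rcases ha.eq_or_lt with rfl | hlt
  · exact le_rfl
  have hd : Differentiable ℝ M.γ := hM.γ_smooth.differentiable (by simp)
  have h := hM.γ_convex.convexOn.deriv_le_slope (mem_univ 0) (mem_univ a) hlt (hd 0)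
  rw [hM.γ_zero, slope_def_field, le_div_iff₀ (sub_pos.2 hlt)] at h
  linarith

lemma Material.Admissible.C_posDef (hM : M.Admissible Ω) (a : ℝ) : (M.C a).SymPosDef :=
  hM.C₁_posDef.smul (hM.γ_pos a)

lemma Material.Admissible.D_posDef (hM : M.Admissible Ω) (a : ℝ) : (M.D a).SymPosDef :=
  hM.D₀_posDef.add ((hM.C_posDef a).smul hM.χ_pos)

lemma Material.inner_C (M : Material d) (a : ℝ) (e e' : SymMat d) :
    inner ℝ (M.C a e) e' = M.γ a * inner ℝ (M.C₁ e) e' := by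
  unfold Material.C
  rw [smul_apply, SymMat.inner_smul_left]

lemma Material.inner_D (M : Material d) (a : ℝ) (e e' : SymMat d) :
    inner ℝ (M.D a e) e' = inner ℝ (M.D₀ e) e' + M.χ * (M.γ a * inner ℝ (M.C₁ e) e') := by
  unfold Material.D
  rw [add_apply, inner_add_left, smul_apply, SymMat.inner_smul_left, Material.inner_C]

/-- Both admissible viscous tensors in the reference time step are positive definite and lie
below `𝔻(a)`. -/
lemma Material.Admissible.viscous_bound (hM : M.Admissible Ω) {A : Tensor4 d}
    (hA : A = M.D₀ ∨ A = M.D 0) :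
    A.SymPosDef ∧ ∀ a, 0 ≤ a → ∀ e, inner ℝ (A e) e ≤ inner ℝ (M.D a e) e := by
  have hC : ∀ e, 0 ≤ inner ℝ (M.C₁ e) e := hM.C₁_posDef.nonneg
  rcases hA with rfl | rfl
  · refine ⟨hM.D₀_posDef, fun a _ e => ?_⟩
    rw [Material.inner_D]
    have := mul_nonneg hM.χ_pos.le (mul_nonneg (hM.γ_pos a).le (hC e))
    linarith
  · refine ⟨hM.D_posDef 0, fun a ha e => ?_⟩
    rw [Material.inner_D, Material.inner_D]
    have := mul_le_mul_of_nonneg_left (mul_le_mul_of_nonneg_right (hM.γ_zero_le ha) (hC e))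
      hM.χ_pos.le
    linarith

/-- What positivity of the reference time step says about the data: with `m = min γ''` and
`G = max (γ')²` on `[0,1]`, the tensor `ℂ₁` is controlled by `𝔻`. -/
lemma Material.Admissible.tau0_spec (hM : M.Admissible Ω) {A : Tensor4 d} (hA : A.SymPosDef)
    (h0 : 0 < M.tau0 A) :
    ∃ m G : ℝ, 0 < m ∧ (∀ x ∈ Icc (0 : ℝ) 1, m ≤ deriv (deriv M.γ) x) ∧
      (∀ x ∈ Icc (0 : ℝ) 1, deriv M.γ x ^ 2 ≤ G) ∧ m ^ 2 ≤ G ∧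
      ∀ e, 2 * (G / m) * M.tau0 A * inner ℝ (M.C₁ e) e ≤ inner ℝ (A e) e := by
  have hγ1 : ContDiff ℝ ∞ (deriv M.γ) := (contDiff_infty_iff_deriv.1 hM.γ_smooth).2
  have hγ2 : ContDiff ℝ ∞ (deriv (deriv M.γ)) := (contDiff_infty_iff_deriv.1 hγ1).2
  set m := sInf (deriv (deriv M.γ) '' Icc 0 1) with hm
  set G := sSup ((fun a => deriv M.γ a ^ 2) '' Icc 0 1) with hG
  have hmle : ∀ x ∈ Icc (0 : ℝ) 1, m ≤ deriv (deriv M.γ) x := fun x hx =>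
    csInf_le (isCompact_Icc.image hγ2.continuous).bddBelow (mem_image_of_mem _ hx)
  have hGle : ∀ x ∈ Icc (0 : ℝ) 1, deriv M.γ x ^ 2 ≤ G := fun x hx =>
    le_csSup (isCompact_Icc.image (hγ1.continuous.pow 2)).bddAbove
      (mem_image_of_mem (fun a => deriv M.γ a ^ 2) hx)
  have hG0 : 0 ≤ G := (sq_nonneg _).trans (hGle 0 (by simp))
  have hden : 0 ≤ 2 * ‖A.inverse‖ * ‖M.C₁‖ ^ 2 * ‖M.C₁.inverse‖ * G := by positivity
  have hτ : M.tau0 A = m / (2 * ‖A.inverse‖ * ‖M.C₁‖ ^ 2 * ‖M.C₁.inverse‖ * G) := rfl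
  -- Division by zero yields 0, so a positive `tau0` excludes a vanishing denominator. It also
  -- forces m > 0, which strict convexity of γ alone does not.
  have hden' : 0 < 2 * ‖A.inverse‖ * ‖M.C₁‖ ^ 2 * ‖M.C₁.inverse‖ * G := by
    refine hden.lt_of_ne fun h => ?_
    rw [hτ, ← h, div_zero] at h0
    exact lt_irrefl _ h0
  have hm0 : 0 < m := by
    rw [hτ, div_pos_iff] at h0
    rcases h0 with h | h
    · exact h.1
    · linarith [h.2]
  refine ⟨m, G, hm0, hmle, hGle, ?_, fun e => ?_⟩
  -- Since γ'(0) = 0, the mean value theorem gives γ'(1) = γ''(x) ≥ m for some x, hence m² ≤ γ'(1)²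
  -- ≤ G.
  · obtain ⟨x, hx, hx'⟩ := exists_deriv_eq_slope (deriv M.γ) (zero_lt_one' ℝ)
      hγ1.continuous.continuousOn (hγ1.differentiable (by simp)).differentiableOn
    rw [hM.γ_zero] at hx'
    have h1 : m ≤ deriv M.γ 1 := by
      have := hmle x (Ioo_subset_Icc_self hx)
      rw [hx'] at this
      simpa using this
    exact (pow_le_pow_left₀ hm0.le h1 2).trans (hGle 1 (by simp))
  · have hGpos : 0 < G := pos_of_mul_pos_right hden' (by positivity)
    have hci : 0 < 2 * ‖A.inverse‖ * ‖M.C₁‖ ^ 2 * ‖M.C₁.inverse‖ :=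
      pos_of_mul_pos_left hden' hG0
    have e1 : 2 * (G / m) * M.tau0 A = 1 / (‖A.inverse‖ * ‖M.C₁‖ ^ 2 * ‖M.C₁.inverse‖) := by
      rw [hτ]
      have : 0 < ‖A.inverse‖ * ‖M.C₁‖ ^ 2 * ‖M.C₁.inverse‖ := by
        linarith [hci]
      field_simp
    have hK : 0 < ‖A.inverse‖ * ‖M.C₁‖ ^ 2 * ‖M.C₁.inverse‖ := by linarith [hci]
    rw [e1, div_mul_eq_mul_div, one_mul, div_le_iff₀ hK]
    -- The detour through `M.C₁.inverse` only inserts the factor ‖ℂ₁‖‖ℂ₁⁻¹‖ occurring in `tau0`.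
    calc inner ℝ (M.C₁ e) e ≤ ‖M.C₁‖ * ‖e‖ ^ 2 := Tensor4.inner_le _ _
      _ ≤ ‖M.C₁‖ * (‖M.C₁.inverse‖ * inner ℝ (M.C₁ e) e) := by
          gcongr
          exact hM.C₁_posDef.norm_sq_le e
      _ ≤ ‖M.C₁‖ * (‖M.C₁.inverse‖ * (‖M.C₁‖ * ‖e‖ ^ 2)) := by
          gcongr
          exact Tensor4.inner_le _ _
      _ ≤ ‖M.C₁‖ * (‖M.C₁.inverse‖ * (‖M.C₁‖ * (‖A.inverse‖ * inner ℝ (A e) e))) := by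
          gcongr
          exact hA.norm_sq_le e
      _ = _ := by ring

/-- The increment of the elastic energy is bounded by the stress power, the damage driving force,
and a fraction `√(τ/τ₀)` of the viscous dissipation. -/
lemma Material.Admissible.elastic_increment_le (hM : M.Admissible Ω) {A : Tensor4 d}
    (hA : A = M.D₀ ∨ A = M.D 0) {τ : ℝ} (hτ : 0 < τ) (hτ₀ : τ ≤ M.tau0 A) {a b : ℝ}
    (ha : a ∈ Icc (0 : ℝ) 1) (hb : b ∈ Icc (0 : ℝ) 1) (hba : b ≤ a) (e₀ r : SymMat d) :
    1 / 2 * inner ℝ (M.C b (e₀ + τ • r)) (e₀ + τ • r) - 1 / 2 * inner ℝ (M.C a e₀) e₀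
      ≤ τ * inner ℝ (M.C b (e₀ + τ • r)) r
        + 1 / 2 * deriv M.γ b * inner ℝ (M.C₁ (e₀ + τ • r)) (e₀ + τ • r) * (b - a)
        + √(τ / M.tau0 A) * τ * inner ℝ (M.D a r) r := by
  obtain ⟨hApos, hAD⟩ := hM.viscous_bound hA
  have h0 : 0 < M.tau0 A := hτ.trans_le hτ₀
  obtain ⟨m, G, hm, hmle, hGle, hmG, hGe⟩ := hM.tau0_spec hApos h0
  have hγ := quadratic_lower_bound_of_deriv2_ge hM.γ_smooth hmle hb.1 hba ha.2
  have hg := hGle b hb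
  have hg0 := hM.deriv_γ_nonneg hb.1
  have hP := hM.C₁_posDef.nonneg e₀
  have hZ := hM.C₁_posDef.nonneg r
  -- The weights are chosen so that, after division by m, the first term is the gain m(a-b)²/4 ·
  -- ℂ₁e₀:e₀ from strong convexity and the second the mixed term to be absorbed.
  have hQ := hM.C₁_posDef.quadratic_nonneg e₀ r (m * (a - b) / 2) (-(deriv M.γ b * τ))
  -- With s = √(τ/τ₀), one factor τ is written as s²τ₀; the calibration of τ₀ then gives the factor
  -- s², and s² ≤ s.
  have hvis : 2 * (G / m) * τ ^ 2 * inner ℝ (M.C₁ r) r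
      ≤ √(τ / M.tau0 A) * τ * inner ℝ (M.D a r) r := by
    set s := √(τ / M.tau0 A) with hs
    have hs0 : 0 ≤ s := Real.sqrt_nonneg _
    have hs1 : s ≤ 1 := Real.sqrt_le_one.2 ((div_le_one h0).2 hτ₀)
    have hss : s * s * M.tau0 A = τ := by
      rw [hs, Real.mul_self_sqrt (by positivity)]
      field_simp
    have hD0 : 0 ≤ inner ℝ (M.D a r) r := (hM.D_posDef a).nonneg r
    calc 2 * (G / m) * τ ^ 2 * inner ℝ (M.C₁ r) r
        = s * s * τ * (2 * (G / m) * M.tau0 A * inner ℝ (M.C₁ r) r) := by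
          rw [show s * s * τ * (2 * (G / m) * M.tau0 A * inner ℝ (M.C₁ r) r)
            = (s * s * M.tau0 A) * (2 * (G / m) * τ * inner ℝ (M.C₁ r) r) by ring, hss]
          ring
      _ ≤ s * s * τ * inner ℝ (M.D a r) r := by
          gcongr
          exact (hGe r).trans (hAD a ha.1 r)
      _ ≤ s * 1 * τ * inner ℝ (M.D a r) r := by gcongr
      _ = _ := by ring
  have hX := hM.C₁_posDef.comm r e₀
  simp only [Material.inner_C, map_add, map_smul, inner_add_left, inner_add_right,
    SymMat.inner_smul_left, SymMat.inner_smul_right, hX]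
  refine le_trans ?_ (add_le_add_right hvis _)
  set P : ℝ := inner ℝ (M.C₁ e₀) e₀
  set X : ℝ := inner ℝ (M.C₁ e₀) r
  set Z : ℝ := inner ℝ (M.C₁ r) r
  set g := deriv M.γ b
  obtain ⟨x, hx⟩ : ∃ x, x = a - b := ⟨_, rfl⟩
  rw [← hx] at hγ hQ
  have hx0 : 0 ≤ x := by linarith
  have hx1 : x ≤ 1 := by linarith [ha.2, hb.1]
  rw [show b - a = -x by linarith]
  have h1 : 0 ≤ m / 4 * x ^ 2 * P - g * x * τ * X + g ^ 2 / m * τ ^ 2 * Z := by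
    have : m / 4 * x ^ 2 * P - g * x * τ * X + g ^ 2 / m * τ ^ 2 * Z
      = ((m * x / 2) ^ 2 * P + 2 * (m * x / 2) * -(g * τ) * X + (-(g * τ)) ^ 2 * Z) / m := by
      field_simp
      ring
    rw [this]
    positivity
  -- The first summand comes from Young's inequality, the second from the quadratic strain term in
  -- the driving force. Each is at most G/m; the second because x ≤ 1, gm ≤ (g² + m²)/2 and m² ≤ G.
  have h2 : g ^ 2 / m + g * x / 2 ≤ 2 * (G / m) := by
    have h3 : g * x * m / 2 ≤ G := by
      have : g * x ≤ g := mul_le_of_le_one_right hg0 hx1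
      nlinarith [mul_le_mul_of_nonneg_right this hm.le, sq_nonneg (g - m)]
    have h4 : 2 * (G / m) - (g ^ 2 / m + g * x / 2) = ((G - g ^ 2) + (G - g * x * m / 2)) / m := by
      field_simp
      ring
    have : 0 ≤ ((G - g ^ 2) + (G - g * x * m / 2)) / m := by
      apply div_nonneg _ hm.le
      linarith
    linarith
  have h5 := mul_le_mul_of_nonneg_right h2 (mul_nonneg (sq_nonneg τ) hZ)
  have h6 := mul_le_mul_of_nonneg_right hγ hP
  have h7 := mul_nonneg (mul_nonneg (hM.γ_pos b).le (sq_nonneg τ)) hZ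
  linarith

end Elastic

/-! ### The dissipation potential: difference quotients towards `0` -/

section Potential

variable {d : ℕ} {M : Material d} {Ω : Set (Pt d)}

lemma Material.Admissible.coe_toReal_ζ (hM : M.Admissible Ω) {v : ℝ} (hv : M.ζ v ≠ ⊤) :
    (((M.ζ v).toReal : ℝ) : EReal) = M.ζ v :=
  EReal.coe_toReal hv (hM.ζ_proper v)

lemma Material.Admissible.nonpos_of_ζ_ne_top (hM : M.Admissible Ω) {v : ℝ} (hv : M.ζ v ≠ ⊤) :
    v ≤ 0 := by
  by_contra h
  exact hv (hM.ζ_top v (not_le.1 h))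

lemma Material.Admissible.ζ_zero_ne_top (hM : M.Admissible Ω) {v : ℝ} (hv : M.ζ v ≠ ⊤) :
    M.ζ 0 ≠ ⊤ :=
  ne_top_of_le_ne_top hv (hM.ζ_min v)

lemma Material.Admissible.toReal_ζ_zero_le (hM : M.Admissible Ω) {v : ℝ} (hv : M.ζ v ≠ ⊤) :
    (M.ζ 0).toReal ≤ (M.ζ v).toReal :=
  EReal.toReal_le_toReal (hM.ζ_min v) (hM.ζ_proper 0) hv

lemma Material.Admissible.convexOn_toReal_ζ (hM : M.Admissible Ω) :
    ConvexOn ℝ {v | M.ζ v ≠ ⊤} (fun v => (M.ζ v).toReal) := by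
  have key : ∀ x y a b : ℝ, M.ζ x ≠ ⊤ → M.ζ y ≠ ⊤ → 0 ≤ a → 0 ≤ b → a + b = 1 →
      M.ζ (a * x + b * y) ≤ ((a * (M.ζ x).toReal + b * (M.ζ y).toReal : ℝ) : EReal) := by
    intro x y a b hx hy ha hb hab
    have h := hM.ζ_convex x y a b ha hb hab
    rw [← hM.coe_toReal_ζ hx, ← hM.coe_toReal_ζ hy] at h
    exact_mod_cast h
  refine ⟨fun x hx y hy a b ha hb hab => ?_, fun x hx y hy a b ha hb hab => ?_⟩
  · exact ne_top_of_le_ne_top (EReal.coe_ne_top _) (key x y a b hx hy ha hb hab)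
  · have h := key x y a b hx hy ha hb hab
    exact EReal.toReal_le_toReal h (hM.ζ_proper _) (EReal.coe_ne_top _)

lemma Material.Admissible.mem_subdiff_iff (hM : M.Admissible Ω) {v ξ : ℝ} (hv : M.ζ v ≠ ⊤) :
    ξ ∈ subdiff M.ζ v ↔
      ∀ w, M.ζ w ≠ ⊤ → (M.ζ v).toReal + ξ * (w - v) ≤ (M.ζ w).toReal := by
  constructor
  · intro h w hw
    have := h.2 w
    rw [← hM.coe_toReal_ζ hv, ← hM.coe_toReal_ζ hw] at this
    exact_mod_cast this
  · refine fun h => ⟨hv, fun w => ?_⟩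
    by_cases hw : M.ζ w = ⊤
    · rw [hw]
      exact le_top
    · rw [← hM.coe_toReal_ζ hv, ← hM.coe_toReal_ζ hw]
      exact_mod_cast h w hw

lemma Material.Admissible.subdiffPower_nonneg (hM : M.Admissible Ω) (v : ℝ) :
    0 ≤ subdiffPower M.ζ v := by
  refine Real.sInf_nonneg ?_
  rintro _ ⟨ξ, hξ, rfl⟩
  have h := (hM.mem_subdiff_iff hξ.1).1 hξ 0 (hM.ζ_zero_ne_top hξ.1)
  have h' := hM.toReal_ζ_zero_le hξ.1
  simp only
  linarith

/-- Difference quotient of `ζ` at `v` in the direction of `0`. -/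
def decay (ζ : ℝ → EReal) (ε v : ℝ) : ℝ :=
  ((ζ v).toReal - (ζ ((1 - ε) * v)).toReal) / ε

lemma Material.Admissible.ζ_shrink_ne_top (hM : M.Admissible Ω) {v ε : ℝ} (hv : M.ζ v ≠ ⊤)
    (h0 : 0 ≤ ε) (h1 : ε ≤ 1) : M.ζ ((1 - ε) * v) ≠ ⊤ := by
  have := hM.convexOn_toReal_ζ.1 hv (hM.ζ_zero_ne_top hv) (sub_nonneg.2 h1) h0 (by ring)
  simpa using this

/-- By convexity, since (1-ε)v lies on the segment from v to (1-δ)v. -/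
lemma Material.Admissible.decay_antitone (hM : M.Admissible Ω) {v ε δ : ℝ} (hv : M.ζ v ≠ ⊤)
    (h0 : 0 < ε) (h1 : ε ≤ δ) (h2 : δ ≤ 1) : decay M.ζ δ v ≤ decay M.ζ ε v := by
  have hδ : 0 < δ := h0.trans_le h1
  have h := hM.convexOn_toReal_ζ.2 hv (hM.ζ_shrink_ne_top hv hδ.le h2)
    (sub_nonneg.2 ((div_le_one hδ).2 h1)) (div_nonneg h0.le hδ.le) (by ring)
  have e : (1 - ε / δ) • v + (ε / δ) • ((1 - δ) * v) = (1 - ε) * v := by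
    simp only [smul_eq_mul]
    field_simp
    ring
  rw [e] at h
  simp only [smul_eq_mul] at h
  unfold decay
  rw [div_le_div_iff₀ hδ h0]
  have h3 := mul_le_mul_of_nonneg_left h hδ.le
  have e2 : δ * ((1 - ε / δ) * (M.ζ v).toReal + ε / δ * (M.ζ ((1 - δ) * v)).toReal)
      = (δ - ε) * (M.ζ v).toReal + ε * (M.ζ ((1 - δ) * v)).toReal := by
    field_simp
  rw [e2] at h3
  linarith

lemma Material.Admissible.decay_nonneg (hM : M.Admissible Ω) {v ε : ℝ} (hv : M.ζ v ≠ ⊤)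
    (h0 : 0 < ε) (h1 : ε ≤ 1) : 0 ≤ decay M.ζ ε v := by
  refine le_trans ?_ (hM.decay_antitone hv h0 h1 le_rfl)
  have := hM.toReal_ζ_zero_le hv
  simpa [decay] using this

/-- For v < 0, moving towards 0 means moving right, so L is v times the right derivative of ζ at v.
That derivative is the largest subgradient, and multiplication by v < 0 makes it the least element
of v∂ζ(v). Finiteness of L matters: at the left end of the domain the slope may be -∞ and the
subdifferential empty. -/
lemma Material.Admissible.subdiffPower_eq_of_tendsto (hM : M.Admissible Ω) {v L : ℝ}
    (hv : M.ζ v ≠ ⊤) {ε : ℕ → ℝ} (hε : ∀ n, 0 < ε n) (hε1 : ∀ n, ε n ≤ 1)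
    (hε0 : Tendsto ε atTop (𝓝 0)) (hL : Tendsto (fun n => decay M.ζ (ε n) v) atTop (𝓝 L)) :
    subdiffPower M.ζ v = L := by
  have hv0 := hM.nonpos_of_ζ_ne_top hv
  have hlow : ∀ ξ ∈ subdiff M.ζ v, L ≤ v * ξ := by
    intro ξ hξ
    refine le_of_tendsto' hL fun n => ?_
    have h := (hM.mem_subdiff_iff hv).1 hξ _ (hM.ζ_shrink_ne_top hv (hε n).le (hε1 n))
    unfold decay
    rw [div_le_iff₀ (hε n)]
    linarith
  rcases hv0.eq_or_lt with rfl | hneg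
  · have h0 : (fun n => decay M.ζ (ε n) 0) = fun _ => (0 : ℝ) := by
      funext n
      simp [decay]
    rw [h0] at hL
    rw [← tendsto_nhds_unique tendsto_const_nhds hL]
    refine le_antisymm ?_ (hM.subdiffPower_nonneg 0)
    refine Real.sInf_nonpos ?_
    rintro _ ⟨ξ, -, rfl⟩
    simp
  have hmem : L / v ∈ subdiff M.ζ v := by
    rw [hM.mem_subdiff_iff hv]
    intro w hw
    have hdiv : ∀ n, decay M.ζ (ε n) v * ε n
        = (M.ζ v).toReal - (M.ζ ((1 - ε n) * v)).toReal := fun n =>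
      div_mul_cancel₀ _ (hε n).ne'
    have hpos : ∀ n, 0 < -(ε n * v) := fun n => neg_pos.2 (mul_neg_of_pos_of_neg (hε n) hneg)
    have hlim : v * ((M.ζ w).toReal - (M.ζ v).toReal) ≤ L * (w - v) := by
      refine ge_of_tendsto (hL.mul_const (w - v)) ?_
      -- To the left of v, slopes over adjacent intervals are compared. To the right, the secant
      -- from v to (1 - ε n)v is compared with that from v to w once (1 - ε n)v < w.
      rcases lt_trichotomy w v with h | rfl | h
      · refine Eventually.of_forall fun n => ?_
        have hs := hM.convexOn_toReal_ζ.slope_mono_adjacent hw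
          (hM.ζ_shrink_ne_top hv (hε n).le (hε1 n)) h
          (show v < (1 - ε n) * v by linarith [hpos n])
        rw [div_le_div_iff₀ (by linarith) (by linarith [hpos n])] at hs
        refine le_of_mul_le_mul_left ?_ (hε n)
        have := congrArg (· * (w - v)) (hdiv n)
        linarith
      · simp
      · have hev : ∀ᶠ n in atTop, -(ε n * v) < w - v := by
          have : Tendsto (fun n => -(ε n * v)) atTop (𝓝 0) := by simpa using (hε0.mul_const v).neg
          exact this.eventually (gt_mem_nhds (sub_pos.2 h))
        filter_upwards [hev] with n hn
        have hs := hM.convexOn_toReal_ζ.secant_mono (a := v) hv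
          (hM.ζ_shrink_ne_top hv (hε n).le (hε1 n)) hw (by linarith [hpos n]) h.ne'
          (by linarith [hpos n])
        rw [div_le_div_iff₀ (by linarith [hpos n]) (by linarith)] at hs
        refine le_of_mul_le_mul_left ?_ (hε n)
        have := congrArg (· * (w - v)) (hdiv n)
        linarith
    have e : L / v * (w - v) = L * (w - v) / v := by ring
    rw [e, ← le_sub_iff_add_le', div_le_iff_of_neg hneg]
    linarith
  refine le_antisymm (csInf_le ⟨L, ?_⟩ ⟨L / v, hmem, ?_⟩) (le_csInf ⟨_, mem_image_of_mem _ hmem⟩ ?_)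
  · rintro _ ⟨ξ, hξ, rfl⟩
    exact hlow ξ hξ
  · exact mul_div_cancel₀ L hneg.ne
  · rintro _ ⟨ξ, hξ, rfl⟩
    exact hlow ξ hξ

end Potential

/-- Monotone convergence for difference quotients with uniformly bounded integrals, where the
limit is only identified at points where it is finite. -/
lemma integrable_and_integral_le_of_monotone {X : Type*} [MeasurableSpace X] {μ : Measure X}
    {q : ℕ → X → ℝ} {F : X → ℝ} {K : ℝ} (hq : ∀ n, Integrable (q n) μ)
    (h0 : ∀ n, ∀ᵐ x ∂μ, 0 ≤ q n x) (hmono : ∀ᵐ x ∂μ, Monotone fun n => q n x)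
    (hK : ∀ n, ∫ x, q n x ∂μ ≤ K)
    (hF : ∀ᵐ x ∂μ, ∀ L, Tendsto (fun n => q n x) atTop (𝓝 L) → F x = L) :
    Integrable F μ ∧ ∫ x, F x ∂μ ≤ K := by
  set S : X → ℝ≥0∞ := fun x => ⨆ n, ENNReal.ofReal (q n x) with hS
  have hm : ∀ n, AEMeasurable (fun x => ENNReal.ofReal (q n x)) μ := fun n =>
    (hq n).1.aemeasurable.ennreal_ofReal
  have hmonoS : ∀ᵐ x ∂μ, Monotone fun n => ENNReal.ofReal (q n x) := by
    filter_upwards [hmono] with x hx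
    exact fun a b hab => ENNReal.ofReal_le_ofReal (hx hab)
  have hle : ∫⁻ x, S x ∂μ ≤ ENNReal.ofReal K := by
    rw [hS, lintegral_iSup' hm hmonoS]
    refine iSup_le fun n => ?_
    rw [← ofReal_integral_eq_lintegral_ofReal (hq n) (h0 n)]
    exact ENNReal.ofReal_le_ofReal (hK n)
  have hK0 : 0 ≤ K := (integral_nonneg_of_ae (h0 0)).trans (hK 0)
  have hfin : ∫⁻ x, S x ∂μ ≠ ⊤ := ne_top_of_le_ne_top ENNReal.ofReal_ne_top hle
  have hSm : AEMeasurable S μ := AEMeasurable.iSup hm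
  -- The supremum has finite integral, hence is finite almost everywhere; only there does the
  -- sequence have a real limit that `hF` can identify.
  have hFS : F =ᵐ[μ] fun x => (S x).toReal := by
    filter_upwards [hmonoS, ae_all_iff.2 h0, hF, ae_lt_top' hSm hfin] with x h1 h2 h3 h4
    refine h3 _ ?_
    have h5 := (ENNReal.tendsto_toReal h4.ne).comp (tendsto_atTop_iSup h1)
    refine h5.congr fun n => ?_
    exact ENNReal.toReal_ofReal (h2 n)
  refine ⟨(integrable_toReal_of_lintegral_ne_top hSm hfin).congr hFS.symm, ?_⟩
  rw [integral_congr_ae hFS, integral_toReal hSm (ae_lt_top' hSm hfin)]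
  exact ENNReal.toReal_le_of_le_ofReal hK0 hle

/-! ### Integrability of the energy densities -/

section Integrability

lemma memLp_top_comp_of_mem_Icc {X : Type*} [MeasurableSpace X] {μ : Measure X} {a : X → ℝ}
    {h : ℝ → ℝ} (hh : ContinuousOn h (Icc 0 1)) (ha : AEStronglyMeasurable a μ)
    (hr : ∀ᵐ x ∂μ, a x ∈ Icc (0 : ℝ) 1) : MemLp (fun x => h (a x)) ⊤ μ := by
  -- Only the values of `h` on [0,1] are controlled; extending it constantly beyond the endpoints
  -- secures measurability of the composition.
  have hc : Continuous (IccExtend (zero_le_one' ℝ) ((Icc (0 : ℝ) 1).domRestrict h)) :=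
    (continuousOn_iff_continuous_domRestrict.1 hh).Icc_extend'
  have he : (fun x => IccExtend (zero_le_one' ℝ) ((Icc (0 : ℝ) 1).domRestrict h) (a x))
      =ᵐ[μ] fun x => h (a x) := by
    filter_upwards [hr] with x hx
    rw [IccExtend_of_mem _ _ hx]
    rfl
  obtain ⟨C, hC⟩ := isCompact_Icc.exists_bound_of_continuousOn hh
  refine memLp_top_of_bound ((hc.comp_aestronglyMeasurable ha).congr he) C ?_
  filter_upwards [hr] with x hx
  exact hC _ hx

lemma integrable_inner_tensor {X : Type*} [MeasurableSpace X] {μ : Measure X} {d : ℕ}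
    (A : Tensor4 d) {e e' : X → SymMat d} (he : MemLp e 2 μ) (he' : MemLp e' 2 μ) :
    Integrable (fun x => inner ℝ (A (e x)) (e' x)) μ := by
  have h := (he.norm.integrable_mul he'.norm).const_mul ‖A‖
  refine h.mono' ((A.continuous.comp_aestronglyMeasurable he.1).inner he'.1) ?_
  refine Eventually.of_forall fun x => ?_
  calc ‖inner ℝ (A (e x)) (e' x)‖ ≤ ‖A (e x)‖ * ‖e' x‖ := norm_inner_le_norm _ _
    _ ≤ ‖A‖ * ‖e x‖ * ‖e' x‖ := by gcongr; exact A.le_opNorm _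
    _ = _ := by simp only [Pi.mul_apply]; ring

variable {d : ℕ} {M : Material d} {Ω : Set (Pt d)}

lemma Material.Admissible.integrable_inner_C (hM : M.Admissible Ω) {a : Pt d → ℝ}
    (ha : AEStronglyMeasurable a (volume.restrict Ω))
    (hr : ∀ᵐ x ∂(volume.restrict Ω), a x ∈ Icc (0 : ℝ) 1) {e e' : Pt d → SymMat d}
    (he : MemLp e 2 (volume.restrict Ω)) (he' : MemLp e' 2 (volume.restrict Ω)) :
    IntegrableOn (fun x => inner ℝ (M.C (a x) (e x)) (e' x)) Ω := by
  simp only [Material.inner_C]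
  exact (integrable_inner_tensor M.C₁ he he').mul_of_top_right
    (memLp_top_comp_of_mem_Icc hM.γ_smooth.continuous.continuousOn ha hr)

lemma Material.Admissible.integrable_inner_D (hM : M.Admissible Ω) {a : Pt d → ℝ}
    (ha : AEStronglyMeasurable a (volume.restrict Ω))
    (hr : ∀ᵐ x ∂(volume.restrict Ω), a x ∈ Icc (0 : ℝ) 1) {e e' : Pt d → SymMat d}
    (he : MemLp e 2 (volume.restrict Ω)) (he' : MemLp e' 2 (volume.restrict Ω)) :
    IntegrableOn (fun x => inner ℝ (M.D (a x) (e x)) (e' x)) Ω := by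
  have h := hM.integrable_inner_C ha hr he he'
  simp only [Material.inner_C] at h
  simp only [Material.inner_D]
  exact (integrable_inner_tensor M.D₀ he he').add (h.const_mul M.χ)

lemma Material.Admissible.integrable_rpow_weakGrad (hM : M.Admissible Ω) (hΩ : IsOpen Ω)
    {a : Pt d → ℝ} (ha : MemW1 Ω (ENNReal.ofReal M.p) a) :
    IntegrableOn (fun x => ‖weakGrad Ω a x‖ ^ M.p) Ω := by
  have hp : 0 < M.p := zero_lt_one.trans hM.one_lt_p
  have h := (ha.memLp_weakGrad hΩ).integrable_norm_rpow (by simpa using hp) ENNReal.ofReal_ne_top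
  rwa [ENNReal.toReal_ofReal hp.le] at h

lemma Material.Admissible.integrable_stored (hM : M.Admissible Ω) (hΩ : IsOpen Ω)
    (hΩb : volume Ω ≠ ⊤) {u : Pt d → Pt d} {a : Pt d → ℝ} (hu : MemH1 Ω u)
    (ha : MemW1 Ω (ENNReal.ofReal M.p) a)
    (hr : ∀ᵐ x ∂(volume.restrict Ω), a x ∈ Icc (0 : ℝ) 1) :
    IntegrableOn (fun x => 1 / 2 * inner ℝ (M.C (a x) (strain Ω u x)) (strain Ω u x)
      - M.φ (a x) + M.κ / M.p * ‖weakGrad Ω a x‖ ^ M.p) Ω := by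
  have : IsFiniteMeasure (volume.restrict Ω) := ⟨by simpa using hΩb.lt_top⟩
  have hs := hu.memLp_strain hΩ
  have hφ := (memLp_top_comp_of_mem_Icc hM.φ_smooth.continuousOn ha.1.1 hr).integrable le_top
  exact (((hM.integrable_inner_C ha.1.1 hr hs hs).const_mul (1 / 2)).sub hφ).add
    ((hM.integrable_rpow_weakGrad hΩ ha).const_mul _)

/-- Power density of the damage driving force. -/
def Material.drivingPower (M : Material d) (Ω : Set (Pt d)) (u : Pt d → Pt d) (a r : Pt d → ℝ)
    (x : Pt d) : ℝ :=
  (1 / 2 * deriv M.γ (a x) * inner ℝ (M.C₁ (strain Ω u x)) (strain Ω u x) - M.φ' (a x)) * r x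
    + M.κ * ‖weakGrad Ω a x‖ ^ (M.p - 2) * inner ℝ (weakGrad Ω a x) (weakGrad Ω r x)

lemma Material.Admissible.continuousOn_φ' (hM : M.Admissible Ω) :
    ContinuousOn M.φ' (Icc 0 1) :=
  hM.φ_smooth.continuousOn_derivWithin (uniqueDiffOn_Icc zero_lt_one) le_rfl

lemma Material.Admissible.integrable_drivingPower (hM : M.Admissible Ω) (hΩ : IsOpen Ω)
    (hΩb : volume Ω ≠ ⊤) {u : Pt d → Pt d} {a r : Pt d → ℝ} (hu : MemH1 Ω u)
    (ha : MemW1 Ω (ENNReal.ofReal M.p) a)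
    (hr : ∀ᵐ x ∂(volume.restrict Ω), a x ∈ Icc (0 : ℝ) 1)
    (hW : MemW1 Ω (ENNReal.ofReal M.p) r) (htop : MemLp r ⊤ (volume.restrict Ω)) :
    IntegrableOn (M.drivingPower Ω u a r) Ω := by
  have : IsFiniteMeasure (volume.restrict Ω) := ⟨by simpa using hΩb.lt_top⟩
  have hs := hu.memLp_strain hΩ
  have hγ1 : Continuous (deriv M.γ) := (contDiff_infty_iff_deriv.1 hM.γ_smooth).2.continuous
  have h1 : IntegrableOn (fun x => 1 / 2 * (deriv M.γ (a x)
      * inner ℝ (M.C₁ (strain Ω u x)) (strain Ω u x))) Ω :=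
    ((integrable_inner_tensor M.C₁ hs hs).mul_of_top_right
      (memLp_top_comp_of_mem_Icc hγ1.continuousOn ha.1.1 hr)).const_mul (1 / 2)
  have h2 : IntegrableOn (fun x => M.φ' (a x)) Ω :=
    (memLp_top_comp_of_mem_Icc hM.continuousOn_φ' ha.1.1 hr).integrable le_top
  have h3 : IntegrableOn (fun x => ‖weakGrad Ω a x‖ ^ (M.p - 2)
      * inner ℝ (weakGrad Ω a x) (weakGrad Ω r x)) Ω := by
    have hga := (ha.memLp_weakGrad hΩ).1
    have hgr := (hW.memLp_weakGrad hΩ).1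
    refine ((hM.integrable_rpow_weakGrad hΩ hW).add (hM.integrable_rpow_weakGrad hΩ ha)).mono'
      ((hga.norm.aemeasurable.pow_const _).aestronglyMeasurable.mul (hga.inner hgr)) ?_
    exact Eventually.of_forall fun x => abs_rpow_mul_inner_le hM.one_lt_p _ _
  refine (((h1.sub h2).mul_of_top_right htop).add (h3.const_mul M.κ)).congr ?_
  refine Eventually.of_forall fun x => ?_
  simp only [Material.drivingPower, Pi.add_apply, Pi.sub_apply, Pi.mul_apply]
  ring

end Integrability

/-! ### One time step -/

lemma quot_real_eq {d : ℕ} (a : ℕ → Pt d → ℝ) (τ : ℝ) (k : ℕ) :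
    quot a τ k = fun x => τ⁻¹ * a (k + 1) x + -τ⁻¹ * a k x := by
  funext x
  simp only [quot, Pi.smul_apply, Pi.sub_apply, smul_eq_mul]
  ring

lemma quot_eq {d : ℕ} (a : ℕ → Pt d → Pt d) (τ : ℝ) (k : ℕ) :
    quot a τ k = fun x => τ⁻¹ • a (k + 1) x + -τ⁻¹ • a k x := by
  funext x
  simp only [quot, Pi.smul_apply, Pi.sub_apply, smul_sub, neg_smul]
  exact sub_eq_add_neg _ _

namespace IsDiscreteSolution

variable {d : ℕ} {M : Material d} {Ω : Set (Pt d)} {τ : ℝ} {N : ℕ} {F G : ℕ → Pt d → Pt d}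
  {u₀ v₀ : Pt d → Pt d} {α₀ : Pt d → ℝ} {u v : ℕ → Pt d → Pt d} {α : ℕ → Pt d → ℝ}

lemma memH1_quot (hsol : IsDiscreteSolution M Ω τ N F G u₀ v₀ α₀ u v α) {k : ℕ} (hk : k < N) :
    MemH1 Ω (quot u τ k) := by
  rw [quot_eq]
  exact (hsol.u_mem (k + 1) hk).linear_comb (hsol.u_mem _ hk.le) _ _

lemma memW1_quot (hsol : IsDiscreteSolution M Ω τ N F G u₀ v₀ α₀ u v α) {k : ℕ} (hk : k < N) :
    MemW1 Ω (ENNReal.ofReal M.p) (quot α τ k) := by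
  rw [quot_real_eq]
  exact (hsol.α_mem (k + 1) hk).linear_comb (hsol.α_mem _ hk.le) _ _

lemma memLp_top_quot (hsol : IsDiscreteSolution M Ω τ N F G u₀ v₀ α₀ u v α) {k : ℕ}
    (hk : k < N) : MemLp (quot α τ k) ⊤ (volume.restrict Ω) := by
  have h : ∀ j ≤ N, MemLp (α j) ⊤ (volume.restrict Ω) := fun j hj =>
    memLp_top_comp_of_mem_Icc continuousOn_id (hsol.α_mem j hj).1.1 (hsol.α_range j hj)
  rw [quot_real_eq]
  exact ((h _ hk).const_mul _).add ((h _ hk.le).const_mul _)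

lemma strain_succ (hsol : IsDiscreteSolution M Ω τ N F G u₀ v₀ α₀ u v α) (hΩ : IsOpen Ω)
    (hτ : 0 < τ) {k : ℕ} (hk : k < N) :
    strain Ω (u (k + 1)) =ᵐ[volume.restrict Ω]
      fun x => strain Ω (u k) x + τ • strain Ω (quot u τ k) x := by
  have h := strain_linear_comb hΩ (hsol.u_mem (k + 1) hk) (hsol.u_mem _ hk.le) τ⁻¹ (-τ⁻¹)
  rw [← quot_eq] at h
  filter_upwards [h] with x hx
  rw [hx, smul_add, smul_smul, smul_smul, mul_neg, mul_inv_cancel₀ hτ.ne', one_smul, neg_smul,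
    one_smul]
  abel

lemma weakGrad_succ (hsol : IsDiscreteSolution M Ω τ N F G u₀ v₀ α₀ u v α) (hΩ : IsOpen Ω)
    (hτ : 0 < τ) {k : ℕ} (hk : k < N) :
    weakGrad Ω (α (k + 1)) =ᵐ[volume.restrict Ω]
      fun x => weakGrad Ω (α k) x + τ • weakGrad Ω (quot α τ k) x := by
  have h := weakGrad_linear_comb hΩ (hsol.α_mem (k + 1) hk) (hsol.α_mem _ hk.le) τ⁻¹ (-τ⁻¹)
  rw [← quot_real_eq] at h
  filter_upwards [h] with x hx
  rw [hx, smul_add, smul_smul, smul_smul, mul_neg, mul_inv_cancel₀ hτ.ne', one_smul, neg_smul,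
    one_smul]
  abel

/-- The flow rule tested towards zero rate: the dissipation power of damage is integrable and is
balanced by the driving power. -/
lemma dissipation_le (hsol : IsDiscreteSolution M Ω τ N F G u₀ v₀ α₀ u v α)
    (hM : M.Admissible Ω) (hΩ : IsOpen Ω) (hΩb : volume Ω ≠ ⊤) {k : ℕ} (hk : k < N) :
    IntegrableOn (fun x => subdiffPower M.ζ (quot α τ k x)) Ω ∧
      ∫ x in Ω, subdiffPower M.ζ (quot α τ k x)
        ≤ -∫ x in Ω, M.drivingPower Ω (u (k + 1)) (α (k + 1)) (quot α τ k) x := by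
  have : IsFiniteMeasure (volume.restrict Ω) := ⟨by simpa using hΩb.lt_top⟩
  set r := quot α τ k with hr
  have hrW : MemW1 Ω (ENNReal.ofReal M.p) r := hsol.memW1_quot hk
  have hrT : MemLp r ⊤ (volume.restrict Ω) := hsol.memLp_top_quot hk
  have hfin := hsol.rate_finite k hk
  have hint := hsol.rate_integrable k hk
  have hP : IntegrableOn (M.drivingPower Ω (u (k + 1)) (α (k + 1)) r) Ω :=
    hM.integrable_drivingPower hΩ hΩb (hsol.u_mem (k + 1) hk) (hsol.α_mem (k + 1) hk) (hsol.α_range (k + 1) hk)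
      hrW hrT
  obtain ⟨ε, hε⟩ : ∃ ε : ℕ → ℝ, ε = fun n : ℕ => 1 / ((n : ℝ) + 1) := ⟨_, rfl⟩
  have hε0 : ∀ n, 0 < ε n := fun n => by
    rw [hε]
    positivity
  have hεanti : Antitone ε := by
    intro m n hmn
    rw [hε]
    exact Nat.one_div_le_one_div hmn
  have hε1 : ∀ n, ε n ≤ 1 := fun n => (hεanti (Nat.zero_le n)).trans (by simp [hε])
  have hεlim : Tendsto ε atTop (𝓝 0) := by
    rw [hε]
    exact tendsto_one_div_add_atTop_nhds_zero_nat
  have hzint : ∀ n, IntegrableOn (fun x => (M.ζ ((1 - ε n) * r x)).toReal) Ω := by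
    intro n
    -- The competitor is admissible because ζ(0) ≤ ζ((1-ε)r) ≤ ζ(r), with both outer terms
    -- integrable on a set of finite measure.
    refine (hint.norm.add (integrable_const |(M.ζ 0).toReal|)).mono'
      (hM.ζ_lsc.measurable.ereal_toReal.comp_aemeasurable
        (hrT.1.aemeasurable.const_mul (1 - ε n))).aestronglyMeasurable ?_
    filter_upwards [hfin] with x hx
    have h1 := hM.decay_nonneg hx (hε0 n) (hε1 n)
    have h2 : 0 ≤ (M.ζ (r x)).toReal - (M.ζ ((1 - ε n) * r x)).toReal := by
      have := mul_nonneg h1 (hε0 n).le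
      rwa [decay, div_mul_cancel₀ _ (hε0 n).ne'] at this
    have h3 := hM.toReal_ζ_zero_le (hM.ζ_shrink_ne_top hx (hε0 n).le (hε1 n))
    rw [Real.norm_eq_abs, abs_le]
    simp only [Pi.add_apply, Real.norm_eq_abs]
    have h4 := neg_abs_le (M.ζ 0).toReal
    have h5 := le_abs_self (M.ζ (r x)).toReal
    have h6 := abs_nonneg (M.ζ 0).toReal
    have h7 := abs_nonneg (M.ζ (r x)).toReal
    constructor <;> linarith
  have hdint : ∀ n, IntegrableOn (fun x => decay M.ζ (ε n) (r x)) Ω := fun n =>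
    (hint.sub (hzint n)).div_const (ε n)
  refine integrable_and_integral_le_of_monotone (q := fun n x => decay M.ζ (ε n) (r x)) hdint
    ?_ ?_ ?_ ?_
  · intro n
    filter_upwards [hfin] with x hx
    exact hM.decay_nonneg hx (hε0 n) (hε1 n)
  · filter_upwards [hfin] with x hx m n hmn
    exact hM.decay_antitone hx (hε0 n) (hεanti hmn) (hε1 m)
  · intro n
    have hz : MemW1 Ω (ENNReal.ofReal M.p) (fun x => (1 - ε n) * r x) := hrW.const_mul _
    have hflow := hsol.flow_rule k hk _ hz (hrT.const_mul _)
      (by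
        filter_upwards [hfin] with x hx
        exact hM.ζ_shrink_ne_top hx (hε0 n).le (hε1 n))
      (hzint n)
    have e : ∫ x in Ω, ((M.ζ ((1 - ε n) * r x)).toReal
        + (1 / 2 * deriv M.γ (α (k + 1) x)
            * inner ℝ (M.C₁ (strain Ω (u (k + 1)) x)) (strain Ω (u (k + 1)) x)
          - M.φ' (α (k + 1) x)) * ((1 - ε n) * r x - r x)
        + M.κ * ‖weakGrad Ω (α (k + 1)) x‖ ^ (M.p - 2)
          * inner ℝ (weakGrad Ω (α (k + 1)) x)
              (weakGrad Ω (fun x => (1 - ε n) * r x) x - weakGrad Ω r x))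
        = ∫ x in Ω, ((M.ζ ((1 - ε n) * r x)).toReal
          - ε n * M.drivingPower Ω (u (k + 1)) (α (k + 1)) r x) := by
      refine integral_congr_ae ?_
      filter_upwards [weakGrad_const_mul hΩ hrW (1 - ε n)] with x hx
      rw [hx, show (1 - ε n) • weakGrad Ω r x - weakGrad Ω r x = (-ε n) • weakGrad Ω r x by
        rw [sub_smul, one_smul, neg_smul]; abel, real_inner_smul_right]
      simp only [Material.drivingPower]
      ring
    rw [e, integral_sub (hzint n) (hP.const_mul _), integral_const_mul] at hflow
    simp only [decay]
    rw [integral_div, integral_sub hint (hzint n), div_le_iff₀ (hε0 n)]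
    linarith
  · filter_upwards [hfin] with x hx L hL
    exact hM.subdiffPower_eq_of_tendsto hx hε0 hε1 hεlim hL

lemma integrable_kinetic (hM : M.Admissible Ω) {w : Pt d → Pt d}
    (hw : MemLp w 2 (volume.restrict Ω)) :
    IntegrableOn (fun x => M.ϱ x / 2 * ‖w x‖ ^ 2) Ω := by
  have h : IntegrableOn (fun x => ‖w x‖ ^ 2) Ω := hw.norm.integrable_sq
  refine ((h.mul_of_top_right hM.ϱ_bounded).div_const 2).congr ?_
  exact Eventually.of_forall fun x => by simp only [Pi.mul_apply]; ring

/-- The momentum balance tested with the velocity. -/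
lemma kinetic_balance (hsol : IsDiscreteSolution M Ω τ N F G u₀ v₀ α₀ u v α)
    (hM : M.Admissible Ω) (hΩ : IsOpen Ω) (hτ : 0 < τ) {k : ℕ} (hk : k < N) :
    M.kinetic Ω (v (k + 1)) - M.kinetic Ω (v k)
      + τ * (∫ x in Ω, inner ℝ (M.C (α (k + 1) x) (strain Ω (u (k + 1)) x))
          (strain Ω (quot u τ k) x))
      + τ * (∫ x in Ω, inner ℝ (M.D (α k x) (strain Ω (quot u τ k) x))
          (strain Ω (quot u τ k) x))
      = τ * load Ω (F (k + 1)) (G (k + 1)) (quot u τ k) := by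
  have hw := hsol.memH1_quot hk
  have hmom := hsol.momentum k hk _ hw
  -- The velocities are only in L²; their mean has a strain because it agrees almost everywhere with
  -- the difference quotient of `u`.
  rw [← strain_congr (hsol.velocity k hk)] at hmom
  have hE := hw.memLp_strain hΩ
  have i1 := integrable_kinetic hM (hsol.v_mem (k + 1) hk)
  have i0 := integrable_kinetic hM (hsol.v_mem _ hk.le)
  have iC := hM.integrable_inner_C (hsol.α_mem (k + 1) hk).1.1 (hsol.α_range (k + 1) hk)
    ((hsol.u_mem (k + 1) hk).memLp_strain hΩ) hE
  have iD := hM.integrable_inner_D (hsol.α_mem _ hk.le).1.1 (hsol.α_range _ hk.le) hE hE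
  have e : ∫ x in Ω, (M.ϱ x * inner ℝ (quot v τ k x) (quot u τ k x)
      + inner ℝ (M.C (α (k + 1) x) (strain Ω (u (k + 1)) x)
          + M.D (α k x) (strain Ω (quot u τ k) x)) (strain Ω (quot u τ k) x))
      = ∫ x in Ω, (τ⁻¹ * (M.ϱ x / 2 * ‖v (k + 1) x‖ ^ 2 - M.ϱ x / 2 * ‖v k x‖ ^ 2)
        + (inner ℝ (M.C (α (k + 1) x) (strain Ω (u (k + 1)) x)) (strain Ω (quot u τ k) x)
          + inner ℝ (M.D (α k x) (strain Ω (quot u τ k) x)) (strain Ω (quot u τ k) x))) := by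
    refine integral_congr_ae ?_
    filter_upwards [hsol.velocity k hk] with x hx
    rw [inner_add_left, hx]
    -- Midpoint rule: (v_new - v_old)·(v_new + v_old)/2 is half the difference of the squared norms.
    congr 1
    simp only [quot, mid, Pi.smul_apply, Pi.sub_apply, Pi.add_apply, real_inner_smul_left,
      real_inner_smul_right, inner_sub_left, inner_add_right, real_inner_self_eq_norm_sq]
    rw [real_inner_comm (v (k + 1) x) (v k x)]
    ring
  have i10 : IntegrableOn (fun x => M.ϱ x / 2 * ‖v (k + 1) x‖ ^ 2 - M.ϱ x / 2 * ‖v k x‖ ^ 2) Ω :=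
    i1.sub i0
  have iCD := Integrable.fun_add iC iD
  rw [e, integral_add (i10.const_mul _) iCD, integral_const_mul,
    integral_sub i1 i0, integral_add iC iD] at hmom
  rw [← hmom]
  unfold Material.kinetic
  field_simp
  ring

/-- The increment of the stored energy in one step. -/
lemma stored_increment_le (hsol : IsDiscreteSolution M Ω τ N F G u₀ v₀ α₀ u v α)
    (hM : M.Admissible Ω) (hΩ : IsOpen Ω) (hΩb : volume Ω ≠ ⊤) (hτ : 0 < τ) {A : Tensor4 d}
    (hA : A = M.D₀ ∨ A = M.D 0) (hτ₀ : τ ≤ M.tau0 A) {k : ℕ} (hk : k < N) :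
    M.stored Ω (u (k + 1)) (α (k + 1)) - M.stored Ω (u k) (α k)
      ≤ τ * (∫ x in Ω, inner ℝ (M.C (α (k + 1) x) (strain Ω (u (k + 1)) x))
          (strain Ω (quot u τ k) x))
        + τ * (∫ x in Ω, M.drivingPower Ω (u (k + 1)) (α (k + 1)) (quot α τ k) x)
        + √(τ / M.tau0 A) * τ * (∫ x in Ω, inner ℝ (M.D (α k x) (strain Ω (quot u τ k) x))
          (strain Ω (quot u τ k) x)) := by
  have hE := (hsol.memH1_quot hk).memLp_strain hΩ
  have iC := hM.integrable_inner_C (hsol.α_mem (k + 1) hk).1.1 (hsol.α_range (k + 1) hk)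
    ((hsol.u_mem (k + 1) hk).memLp_strain hΩ) hE
  have iD := hM.integrable_inner_D (hsol.α_mem _ hk.le).1.1 (hsol.α_range _ hk.le) hE hE
  have iP := hM.integrable_drivingPower hΩ hΩb (hsol.u_mem (k + 1) hk) (hsol.α_mem (k + 1) hk)
    (hsol.α_range (k + 1) hk) (hsol.memW1_quot hk) (hsol.memLp_top_quot hk)
  have i1 := hM.integrable_stored hΩ hΩb (hsol.u_mem (k + 1) hk) (hsol.α_mem (k + 1) hk) (hsol.α_range (k + 1) hk)
  have i0 := hM.integrable_stored hΩ hΩb (hsol.u_mem _ hk.le) (hsol.α_mem _ hk.le)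
    (hsol.α_range _ hk.le)
  have iCP := Integrable.fun_add (iC.const_mul τ) (iP.const_mul τ)
  unfold Material.stored
  rw [← integral_sub i1 i0, ← integral_const_mul, ← integral_const_mul, ← integral_const_mul,
    ← integral_add (iC.const_mul τ) (iP.const_mul τ),
    ← integral_add iCP (iD.const_mul _)]
  refine integral_mono_ae (i1.sub i0) (iCP.add (iD.const_mul _)) ?_
  filter_upwards [hsol.strain_succ hΩ hτ hk, hsol.weakGrad_succ hΩ hτ hk, hsol.rate_finite k hk,
    hsol.α_range (k + 1) hk, hsol.α_range _ hk.le] with x hU hW hfin hb ha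
  have hrτ : α (k + 1) x - α k x = τ * quot α τ k x := by
    simp only [quot, Pi.smul_apply, Pi.sub_apply, smul_eq_mul]
    field_simp
  -- Damage is unidirectional because ζ is infinite at positive rates.
  have hba : α (k + 1) x ≤ α k x := by
    have := mul_nonpos_of_nonneg_of_nonpos hτ.le (hM.nonpos_of_ζ_ne_top hfin)
    linarith
  have hel := hM.elastic_increment_le hA hτ hτ₀ ha hb hba (strain Ω (u k) x)
    (strain Ω (quot u τ k) x)
  rw [← hU, hrτ] at hel
  have hφ := le_tangent_of_concaveOn_Icc hM.φ_concave hM.φ_smooth ha hb hba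
  have hgr := rpow_norm_tangent_le hM.one_lt_p (weakGrad Ω (α k) x) (weakGrad Ω (α (k + 1)) x)
  rw [show weakGrad Ω (α k) x - weakGrad Ω (α (k + 1)) x = (-τ) • weakGrad Ω (quot α τ k) x by
    rw [hW, neg_smul]; abel, real_inner_smul_right] at hgr
  have hgr' := mul_le_mul_of_nonneg_left hgr hM.κ_pos.le
  rw [show α k x - α (k + 1) x = -(τ * quot α τ k x) by linarith] at hφ
  simp only [Material.drivingPower, Material.φ']
  have e1 : ∀ t : ℝ, M.κ * (t / M.p) = M.κ / M.p * t := fun t => by ring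
  rw [mul_add, e1, e1] at hgr'
  linarith

end IsDiscreteSolution

/-! ### Summation over the time steps -/

/-- The level is constant on each half-open interval (jτ, (j+1)τ]; the point 0, of level 0, is
negligible. -/
lemma intervalIntegral_level_eq_sum {τ : ℝ} (hτ : 0 < τ) (H : ℕ → ℝ) (k : ℕ) :
    ∫ s in (0 : ℝ)..(k * τ), H (level τ s) = τ * ∑ j ∈ Finset.range k, H (j + 1) := by
  have hle : ∀ j : ℕ, (j : ℝ) * τ ≤ ((j + 1 : ℕ) : ℝ) * τ := fun j => by
    push_cast
    linarith
  have heq : ∀ j : ℕ, EqOn (fun _ => H (j + 1)) (fun s => H (level τ s))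
      (Ioc ((j : ℝ) * τ) (((j + 1 : ℕ) : ℝ) * τ)) := by
    intro j s hs
    have h2 := hs.2
    push_cast at h2
    simp only [level_eq hτ j hs.1 h2]
  have hint : ∀ j < k, IntervalIntegrable (fun s => H (level τ s)) volume ((j : ℝ) * τ)
      (((j + 1 : ℕ) : ℝ) * τ) := by
    intro j _
    rw [intervalIntegrable_iff_integrableOn_Ioc_of_le (hle j)]
    refine IntegrableOn.congr_fun ?_ (heq j) measurableSet_Ioc
    exact integrableOn_const (by simp)
  have h := intervalIntegral.sum_integral_adjacent_intervals (a := fun j : ℕ => (j : ℝ) * τ) hint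
  simp only [Nat.cast_zero, zero_mul] at h
  rw [← h, Finset.mul_sum]
  refine Finset.sum_congr rfl fun j _ => ?_
  rw [intervalIntegral.integral_of_le (hle j), ← setIntegral_congr_fun measurableSet_Ioc (heq j),
    ← intervalIntegral.integral_of_le (hle j), intervalIntegral.integral_const, smul_eq_mul]
  push_cast
  ring

lemma stored_congr {d : ℕ} (M : Material d) {Ω : Set (Pt d)} {u u' : Pt d → Pt d}
    {a a' : Pt d → ℝ} (hu : u =ᵐ[volume.restrict Ω] u') (ha : a =ᵐ[volume.restrict Ω] a') :
    M.stored Ω u a = M.stored Ω u' a' := by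
  unfold Material.stored
  rw [strain_congr hu, weakGrad_congr ha]
  refine integral_congr_ae ?_
  filter_upwards [ha] with x hx
  rw [hx]

lemma kinetic_congr {d : ℕ} (M : Material d) {Ω : Set (Pt d)} {v v' : Pt d → Pt d}
    (hv : v =ᵐ[volume.restrict Ω] v') : M.kinetic Ω v = M.kinetic Ω v' := by
  refine integral_congr_ae ?_
  filter_upwards [hv] with x hx
  rw [hx]

/-- The energy inequality for one step. -/
lemma IsDiscreteSolution.energy_step {d : ℕ} {M : Material d} {Ω : Set (Pt d)} {τ : ℝ} {N : ℕ}
    {F G : ℕ → Pt d → Pt d} {u₀ v₀ : Pt d → Pt d} {α₀ : Pt d → ℝ} {u v : ℕ → Pt d → Pt d}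
    {α : ℕ → Pt d → ℝ} (hsol : IsDiscreteSolution M Ω τ N F G u₀ v₀ α₀ u v α)
    (hM : M.Admissible Ω) (hΩ : IsOpen Ω) (hΩb : volume Ω ≠ ⊤) (hτ : 0 < τ) {A : Tensor4 d}
    (hA : A = M.D₀ ∨ A = M.D 0) (hτ₀ : τ ≤ M.tau0 A) {k : ℕ} (hk : k < N) :
    M.kinetic Ω (v (k + 1)) + M.stored Ω (u (k + 1)) (α (k + 1))
      + (1 - √(τ / M.tau0 A)) * (τ * M.dissRate Ω (α k) (quot u τ k) (quot α τ k))
      ≤ M.kinetic Ω (v k) + M.stored Ω (u k) (α k)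
        + τ * load Ω (F (k + 1)) (G (k + 1)) (quot u τ k) := by
  have h1 := hsol.kinetic_balance hM hΩ hτ hk
  have h2 := hsol.stored_increment_le hM hΩ hΩb hτ hA hτ₀ hk
  obtain ⟨i3, h3⟩ := hsol.dissipation_le hM hΩ hΩb hk
  have hE := (hsol.memH1_quot hk).memLp_strain hΩ
  have iD := hM.integrable_inner_D (hsol.α_mem _ hk.le).1.1 (hsol.α_range _ hk.le) hE hE
  unfold Material.dissRate
  rw [integral_add iD i3]
  have h4 : 0 ≤ ∫ x in Ω, subdiffPower M.ζ (quot α τ k x) :=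
    integral_nonneg fun x => hM.subdiffPower_nonneg _
  -- Only the viscous part loses the factor 1 - √(τ/τ₀); nonnegativity of the damage dissipation
  -- allows the same factor on it.
  have h5 := mul_nonneg (mul_nonneg (Real.sqrt_nonneg (τ / M.tau0 A)) hτ.le) h4
  have h6 := mul_le_mul_of_nonneg_left h3 hτ.le
  linarith

end DamageScheme

end

/-! ### Energy inequality at the grid times -/

open DamageScheme in
theorem mainTheorem3 {d : ℕ} (hd : d = 2 ∨ d = 3)
    {Ω : Set (Pt d)} (hΩ : IsLipschitzDomain Ω)
    (M : Material d) (hM : M.Admissible Ω)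
    (T : ℝ) (hT : 0 < T)
    (f g : ℝ → Pt d → Pt d)
    (hf : MemLp (fun q : ℝ × Pt d => f q.1 q.2) 2
      ((volume.restrict (Icc 0 T)).prod (volume.restrict Ω)))
    (hg : MemLp (fun q : ℝ × Pt d => g q.1 q.2) 2
      ((volume.restrict (Icc 0 T)).prod (surf Ω)))
    (u₀ v₀ : Pt d → Pt d) (α₀ : Pt d → ℝ)
    (hu₀ : MemH1 Ω u₀) (hv₀ : MemLp v₀ 2 (volume.restrict Ω))
    (hα₀ : MemW1 Ω (ENNReal.ofReal M.p) α₀)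
    (hα₀' : ∀ᵐ x ∂(volume.restrict Ω), α₀ x ∈ Icc (0 : ℝ) 1)
    (τ : ℝ) (hτ : 0 < τ) (N : ℕ) (hN : (N : ℝ) * τ = T)
    (A : Tensor4 d) (hA : A = M.D₀ ∨ A = M.D 0)
    (hτ₀ : τ ≤ M.tau0 A)
    (u v : ℕ → Pt d → Pt d) (α : ℕ → Pt d → ℝ)
    (hsol : IsDiscreteSolution M Ω τ N (timeMean f τ) (timeMean g τ) u₀ v₀ α₀ u v α) :
    (∀ k < N, IntegrableOn (fun x => subdiffPower M.ζ (quot α τ k x)) Ω) ∧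
    ∀ k : ℕ, 1 ≤ k → k ≤ N → ∀ t : ℝ, t = (k : ℝ) * τ →
      M.kinetic Ω (affine v τ t) + M.stored Ω (affine u τ t) (affine α τ t)
        + (1 - √(τ / M.tau0 A)) *
          ∫ s in (0 : ℝ)..t,
            M.dissRate Ω (lower α τ s) (affineDot u τ s) (affineDot α τ s)
      ≤ M.kinetic Ω v₀ + M.stored Ω u₀ α₀
        + ∫ s in (0 : ℝ)..t,
            load Ω (upper (timeMean f τ) τ s) (upper (timeMean g τ) τ s) (affineDot u τ s) := by
  have hΩb : volume Ω ≠ ⊤ := hΩ.isBounded.measure_lt_top.ne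
  refine ⟨fun k hk => (hsol.dissipation_le hM hΩ.isOpen hΩb hk).1, ?_⟩
  have hsum : ∀ k ≤ N, M.kinetic Ω (v k) + M.stored Ω (u k) (α k)
      + (1 - √(τ / M.tau0 A)) * (τ * ∑ j ∈ Finset.range k,
          M.dissRate Ω (α j) (quot u τ j) (quot α τ j))
      ≤ M.kinetic Ω v₀ + M.stored Ω u₀ α₀
        + τ * ∑ j ∈ Finset.range k,
          load Ω (timeMean f τ (j + 1)) (timeMean g τ (j + 1)) (quot u τ j) := by
    intro k
    induction k with
    | zero =>
      intro _
      rw [kinetic_congr M hsol.v_init, stored_congr M hsol.u_init hsol.α_init]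
      simp
    | succ k ih =>
      intro hk
      have h1 := ih (Nat.le_of_succ_le hk)
      have h2 := hsol.energy_step hM hΩ.isOpen hΩb hτ hA hτ₀ (Nat.lt_of_succ_le hk)
      rw [Finset.sum_range_succ, Finset.sum_range_succ, mul_add, mul_add, mul_add]
      linarith
  intro k hk1 hkN t ht
  obtain ⟨j, rfl⟩ : ∃ j, k = j + 1 := ⟨k - 1, by omega⟩
  have haff : t = ((j : ℝ) + 1) * τ := by
    rw [ht]
    push_cast
    rfl
  -- The integrands depend on time only through the level i ≥ 1; the rates and the delayed damage
  -- carry the index i - 1.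
  have hd' := intervalIntegral_level_eq_sum hτ
    (fun i => M.dissRate Ω (α (i - 1)) (quot u τ (i - 1)) (quot α τ (i - 1))) (j + 1)
  have hl' := intervalIntegral_level_eq_sum hτ
    (fun i => load Ω (timeMean f τ i) (timeMean g τ i) (quot u τ (i - 1))) (j + 1)
  rw [← ht] at hd' hl'
  simp only [Nat.add_sub_cancel] at hd' hl'
  have h := hsum (j + 1) hkN
  rw [← hd', ← hl'] at h
  rw [show affine v τ t = v (j + 1) by rw [haff, affine_grid hτ],
    show affine u τ t = u (j + 1) by rw [haff, affine_grid hτ],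
    show affine α τ t = α (j + 1) by rw [haff, affine_grid hτ]]
  exact h
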